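/- Let $n\ge 1$ and $0\le j\le n$. A convex body in $\mathbb R^n$ is a compact convex set with nonempty interior. Let $\omega_k$ be the volume of the unit ball of $\mathbb R^k$, let $G_{n,j}$ be the Grassmannian of $j$-dimensional linear subspaces of $\mathbb R^n$ with its rotation-invariant (Haar) probability measure $\mu_j$, and for $\xi\in G_{n,j}$ let $K|\xi$ be the orthogonal projection of $K$ onto $\xi$. For convex bodies $K_1,\dots,K_j$ in $\mathbb R^n$ define the mixed affine quermassintegral $$\Phi_{n-j}(K_1,\dots,K_j)=\omega_n\left[\int_{G_{n,j}}\left(\frac{V_\xi(K_1|\xi,\dots,K_j|\xi)}{\omega_j}\right)^{-n}d\mu_j(\xi)\right]^{-1/n},$$ where $V_\xi(A_1,\dots,A_j)=\frac1{j!}\sum_{S\subseteq\{1,\dots,j\}}(-1)^{j-|S|}\,\mathrm{vol}_j\big(\sum_{i\in S}A_i\big)$ is the $j$-dimensional mixed volume in $\xi$. Write $$\Phi_{n-j}(K)=\omega_n\left[\int_{G_{n,j}}\left(\frac{\mathrm{vol}_j(K|\xi)}{\omega_j}\right)^{-n}d\mu_j(\xi)\right]^{-1/n}$$ for the affine quermassintegral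 of $K$ (the case $K_1=\dots=K_j=K$), and $\Phi_{n-j}(K,L)=\Phi_{n-j}(K,\dots,K,L)$ with $j-1$ copies of $K$ and one copy of $L$ (for $j=0$ the tuple is empty, and $\Phi_n=\omega_n$). If $K$ and $L$ are convex bodies in $\mathbb R^n$ containing the origin, then $$\Phi_{n-j}(K,L)^{j}\ \ge\ \Phi_{n-j}(K)^{j-1}\,\Phi_{n-j}(L).$$ If moreover $j\ge 2$, then equality holds if and only if $K$ and $L$ are homothetic, that is, $K=cL+t$ for some $c>0$ and $t\in\mathbb R^n$. -/

import Mathlib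

open MeasureTheory
open scoped Pointwise

noncomputable section

namespace MixedAffine

/-- Euclidean `n`-space. -/
abbrev E (n : ℕ) : Type := EuclideanSpace ℝ (Fin n)

/-- The volume `ω_k` of the unit ball of Euclidean `k`-space. -/
def omega (k : ℕ) : ℝ := volume.real (Metric.closedBall (0 : E k) 1)

/-- The mixed volume of `j` compact convex sets in a Euclidean space `F` (of dimension `j`):
`V(K₁, …, K_j) = (1 / j!) ∑_{S ⊆ {1, …, j}} (-1)^{j - |S|} vol (∑_{i ∈ S} K_i)`,
the sums of sets being Minkowski sums (the empty one is `{0}`). -/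
def mixedVolume {F : Type*} [NormedAddCommGroup F] [InnerProductSpace ℝ F]
    [FiniteDimensional ℝ F] [MeasurableSpace F] [BorelSpace F]
    {j : ℕ} (K : Fin j → ConvexBody F) : ℝ :=
  ((j.factorial : ℝ))⁻¹ * ∑ S : Finset (Fin j),
    (-1 : ℝ) ^ (j - S.card) * volume.real ((∑ i ∈ S, K i : ConvexBody F) : Set F)

/-- The orthogonal projection `K | ξ`, as a convex body of the Euclidean space `ξ`. -/
def proj {n : ℕ} (K : ConvexBody (E n)) (ξ : Submodule ℝ (E n)) : ConvexBody ξ where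
  carrier := ξ.orthogonalProjectionOnto '' (K : Set (E n))
  convex' := K.convex.linear_image ξ.orthogonalProjectionOnto.toLinearMap
  isCompact' := K.isCompact.image ξ.orthogonalProjectionOnto.continuous
  nonempty' := K.nonempty.image _

/-- The Grassmannian `G_{n,j}` of `j`-dimensional linear subspaces of Euclidean `n`-space. -/
structure Gr (n j : ℕ) where
  /-- the underlying subspace -/
  space : Submodule ℝ (E n)
  finrank_eq : Module.finrank ℝ space = j

/-- The usual topology of the Grassmannian, given by the distance `‖P_ξ - P_η‖` of the orthogonal
projections. -/
instance (n j : ℕ) : TopologicalSpace (Gr n j) :=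
  TopologicalSpace.induced (fun ξ : Gr n j => ξ.space.starProjection) inferInstance

instance (n j : ℕ) : MeasurableSpace (Gr n j) := borel _

instance (n j : ℕ) : BorelSpace (Gr n j) := ⟨rfl⟩

/-- The orthogonal group `O(n)`, with the topology of the operator norm. -/
abbrev O (n : ℕ) : Type := unitary (E n →L[ℝ] E n)

instance (n : ℕ) : ContinuousStar (E n →L[ℝ] E n) :=
  ⟨(ContinuousLinearMap.adjoint (𝕜 := ℝ) (E := E n) (F := E n)).continuous⟩

instance (n : ℕ) : CompactSpace (O n) := by
  apply isCompact_iff_compactSpace.mp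
  refine Metric.isCompact_of_isClosed_isBounded isClosed_unitary ?_
  refine (Metric.isBounded_closedBall (x := 0) (r := 1)).subset fun g hg => ?_
  rw [mem_closedBall_zero_iff]
  refine ContinuousLinearMap.opNorm_le_bound _ zero_le_one fun x => ?_
  rw [one_mul]
  exact ((Unitary.linearIsometryEquiv ⟨g, hg⟩).norm_map x).le

/-- The Haar probability measure of `O(n)`. -/
def haarO (n : ℕ) : Measure (O n) := Measure.haarMeasure ⊤

instance (n : ℕ) : IsProbabilityMeasure (haarO n) :=
  ⟨by simpa [haarO] using Measure.haarMeasure_self (K₀ := (⊤ : TopologicalSpace.PositiveCompacts (O n)))⟩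

/-- The image `g ξ` of a subspace under an orthogonal transformation. -/
def rotate {n j : ℕ} (g : O n) (ξ : Gr n j) : Gr n j :=
  ⟨ξ.space.map ((Unitary.linearIsometryEquiv g).toLinearEquiv : E n →ₗ[ℝ] E n), by
    rw [LinearEquiv.finrank_map_eq]; exact ξ.finrank_eq⟩

/-- The coordinate subspace spanned by the first `j` vectors of the standard basis. -/
def coordSubspace {n j : ℕ} (hj : j ≤ n) : Gr n j :=
  ⟨Submodule.span ℝ (Set.range fun i : Fin j => EuclideanSpace.single (Fin.castLE hj i) (1 : ℝ)), by
    have h : LinearIndependent ℝ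
        fun i : Fin j => EuclideanSpace.single (Fin.castLE hj i) (1 : ℝ) :=
      (EuclideanSpace.orthonormal_single (𝕜 := ℝ) (ι := Fin n)).linearIndependent.comp
        (Fin.castLE hj) (Fin.castLE_injective hj)
    exact (finrank_span_eq_card h).trans (Fintype.card_fin j)⟩

lemma continuous_rotate {n j : ℕ} (ξ : Gr n j) : Continuous fun g : O n => rotate g ξ := by
  rw [continuous_induced_rng]
  have h : ((fun ξ : Gr n j => ξ.space.starProjection) ∘ fun g : O n => rotate g ξ) =
      fun g : O n => (g : E n →L[ℝ] E n) * ξ.space.starProjection * ((g⁻¹ : O n) : E n →L[ℝ] E n) := by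
    funext g
    ext1 x
    exact Submodule.starProjection_map_apply (Unitary.linearIsometryEquiv g) ξ.space x
  rw [h]
  exact (continuous_subtype_val.mul continuous_const).mul
    (continuous_subtype_val.comp continuous_inv)

/-- The normalized Haar measure `μ_j` on the Grassmannian, i.e. the distribution of `g ξ₀` for a
`j`-dimensional subspace `ξ₀` and a Haar-distributed `g ∈ O(n)`. -/
def grMeasure {n j : ℕ} (hj : j ≤ n) : Measure (Gr n j) :=
  (haarO n).map fun g => rotate g (coordSubspace hj)

instance {n j : ℕ} (hj : j ≤ n) : IsProbabilityMeasure (grMeasure hj) :=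
  Measure.isProbabilityMeasure_map (continuous_rotate _).measurable.aemeasurable

/-- The mixed affine quermassintegral `Φ_{n-j}(K₁, …, K_j)`. -/
def mixedPhi {n j : ℕ} (hj : j ≤ n) (K : Fin j → ConvexBody (E n)) : ℝ :=
  omega n * (∫ ξ : Gr n j, (mixedVolume (fun i => proj (K i) ξ.space) / omega j) ^ (-(n : ℝ))
    ∂(grMeasure hj)) ^ (-1 / (n : ℝ))

/-- Lutwak's affine quermassintegral `Φ_{n-j}(K)`, defined by the volumes of projections. -/
def Phi {n j : ℕ} (hj : j ≤ n) (K : ConvexBody (E n)) : ℝ :=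
  omega n * (∫ ξ : Gr n j, (volume.real (proj K ξ.space : Set ξ.space) / omega j) ^ (-(n : ℝ))
    ∂(grMeasure hj)) ^ (-1 / (n : ℝ))

/-- `Φ_{n-j}(K, L) = Φ_{n-j}(K, …, K, L)` with `j - 1` copies of `K` followed by one of `L`. -/
def Phi₁ {n j : ℕ} (hj : j ≤ n) (K L : ConvexBody (E n)) : ℝ :=
  mixedPhi hj fun i : Fin j => if (i : ℕ) + 1 = j then L else K

/-- `K` and `L` are (positively) homothetic: `K = c L + t` with `c > 0`. -/
def Homothetic {n : ℕ} (K L : ConvexBody (E n)) : Prop :=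
  ∃ c : ℝ, 0 < c ∧ ∃ t : E n, (K : Set (E n)) = c • (L : Set (E n)) + {t}

end MixedAffine

end

noncomputable section

namespace MixedAffine

open Set Filter Topology

/-! ### A one-dimensional Prékopa–Leindler inequality with equality case -/

/-! On each `j`-dimensional subspace, Minkowski's first inequality bounds the mixed volume of the
projections below by `p ^ (1 - 1/j) * q ^ (1/j)`, where `p` and `q` are the volumes of the
projections of `K` and `L`. Raising to the power `-n` and applying Hölder's inequality with
exponents `1 - 1/j` and `1/j` gives the claim (`minkowski_first_rpow`, `affineMean_geom_mean_le`).

Equality forces equality in Minkowski's inequality on every subspace and makes `p / q` constant;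
"every" rather than "almost every" comes from continuity and the full support of Haar measure. So
all projections of `K` are translates of those of `c L` with one common `c`, and the difference of
support functions `h_K - c h_L` is linear on every `j`-dimensional subspace. As `j ≥ 2`, it is
linear on every plane, hence linear, and `K` is a translate of `c L` (`homothetic_of_rotProj`).

Minkowski's inequality follows by differentiating Brunn–Minkowski at `K`. This needs the alternating
sum that defines the mixed volume to be a derivative of volume, which holds because the volume of `s
K + L` is a polynomial in `s` (`exists_polynomial_volume_smul_add`): the gradients of the
logarithmic Laplace transforms of `K` and `L` parametrize `s K + L` up to a null set by a map whose
Jacobian is a polynomial in `s`.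

Brunn–Minkowski is proved by slicing and induction on dimension from the one-dimensional
Prékopa–Leindler inequality. In the equality case, slicing along a functional `u` shows that the
support functions at `u` differ exactly as the centroids do. This difference is linear in `u`, so
the bodies are translates. -/

lemma eq_of_geom_mean_eq_arith_mean {w x y : ℝ} (hw0 : 0 < w) (hw1 : w < 1) (hx : 0 ≤ x)
    (hy : 0 ≤ y) (h : x ^ (1 - w) * y ^ w = (1 - w) * x + w * y) : x = y := by
  have := (Real.geom_mean_eq_arith_mean_weighted_iff_of_pos (Finset.univ : Finset (Fin 2))
    ![1 - w, w] ![x, y] (by intro i _; fin_cases i <;> simp [hw0, hw1]) (by simp)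
    (by intro i _; fin_cases i <;> simp [hx, hy])).1 (by simpa using h)
  simpa using this 0 (Finset.mem_univ _) 1 (Finset.mem_univ _)

/-- The quantile function of a continuous positive density of mass `k` on an interval. -/
lemma exists_quantile {f : ℝ → ℝ} {α β k : ℝ} (hαβ : α < β) (hf : ContinuousOn f (Ioo α β))
    (hpos : ∀ s ∈ Ioo α β, 0 < f s) (hint : IntegrableOn f (Ioo α β))
    (hk : ∫ s in Ioo α β, f s = k) :
    ∃ a : ℝ → ℝ, (∀ θ ∈ Ioo (0 : ℝ) 1, a θ ∈ Ioo α β ∧ HasDerivAt a (k / f (a θ)) θ) ∧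
      a '' Ioo 0 1 = Ioo α β ∧ StrictMonoOn a (Ioo 0 1) := by
  have hIoc : IntegrableOn f (Ioc α β) := by
    rwa [integrableOn_Ioc_iff_integrableOn_Ioo]
  have hIcc : IntegrableOn f (uIcc α β) := by
    rwa [uIcc_of_le hαβ.le, integrableOn_Icc_iff_integrableOn_Ioo]
  set F : ℝ → ℝ := fun s => ∫ x in α..s, f x with hF
  have hFc : ContinuousOn F (Icc α β) := by
    have := intervalIntegral.continuousOn_primitive_interval hIcc
    rwa [uIcc_of_le hαβ.le] at this
  have hFd : ∀ s ∈ Ioo α β, HasDerivAt F (f s) s := by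
    intro s hs
    apply intervalIntegral.integral_hasDerivAt_right
    · rw [intervalIntegrable_iff_integrableOn_Ioc_of_le hs.1.le]
      exact hIoc.mono_set (Ioc_subset_Ioc_right hs.2.le)
    · exact hf.stronglyMeasurableAtFilter isOpen_Ioo s hs
    · exact hf.continuousAt (isOpen_Ioo.mem_nhds hs)
  have hFm : StrictMonoOn F (Icc α β) := by
    apply strictMonoOn_of_deriv_pos (convex_Icc _ _) hFc
    intro s hs
    rw [interior_Icc] at hs
    rw [(hFd s hs).deriv]; exact hpos s hs
  have hF0 : F α = 0 := by simp [hF]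
  have hF1 : F β = k := by
    rw [hF]; simp only
    rw [intervalIntegral.integral_of_le hαβ.le, integral_Ioc_eq_integral_Ioo, hk]
  have hk0 : 0 < k := by
    rw [← hF0, ← hF1]; exact hFm (left_mem_Icc.2 hαβ.le) (right_mem_Icc.2 hαβ.le) hαβ
  have hex : ∀ θ ∈ Ioo (0 : ℝ) 1, ∃ s ∈ Ioo α β, F s = k * θ := by
    intro θ hθ
    have h1 : k * θ ∈ Ioo (F α) (F β) := by
      rw [hF0, hF1]; exact ⟨mul_pos hk0 hθ.1, by nlinarith [hθ.2]⟩
    exact intermediate_value_Ioo hαβ.le hFc h1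
  choose! a ha1 ha2 using hex
  have hmem : ∀ s ∈ Ioo α β, F s / k ∈ Ioo (0 : ℝ) 1 ∧ a (F s / k) = s := by
    intro s hs
    have h0 : 0 < F s := by
      rw [← hF0]; exact hFm (left_mem_Icc.2 hαβ.le) (Ioo_subset_Icc_self hs) hs.1
    have h1 : F s < k := by
      rw [← hF1]; exact hFm (Ioo_subset_Icc_self hs) (right_mem_Icc.2 hαβ.le) hs.2
    have hm : F s / k ∈ Ioo (0 : ℝ) 1 := ⟨div_pos h0 hk0, (div_lt_one hk0).2 h1⟩
    refine ⟨hm, hFm.injOn (Ioo_subset_Icc_self (ha1 _ hm)) (Ioo_subset_Icc_self hs) ?_⟩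
    rw [ha2 _ hm]; field_simp
  have himg : a '' Ioo 0 1 = Ioo α β := by
    apply Subset.antisymm
    · rintro _ ⟨θ, hθ, rfl⟩; exact ha1 θ hθ
    · intro s hs; exact ⟨_, (hmem s hs).1, (hmem s hs).2⟩
  have hmono : StrictMonoOn a (Ioo 0 1) := by
    intro x hx y hy hxy
    rw [← hFm.lt_iff_lt (Ioo_subset_Icc_self (ha1 x hx)) (Ioo_subset_Icc_self (ha1 y hy)),
      ha2 x hx, ha2 y hy]
    gcongr
  refine ⟨a, fun θ hθ => ⟨ha1 θ hθ, ?_⟩, himg, hmono⟩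
  have hca : ContinuousAt a θ := hmono.continuousAt_of_image_mem_nhds (isOpen_Ioo.mem_nhds hθ)
    (by rw [himg]; exact isOpen_Ioo.mem_nhds (ha1 θ hθ))
  have := HasDerivAt.of_local_left_inverse (f := fun s => F s / k) hca
    ((hFd _ (ha1 θ hθ)).div_const k) (div_pos (hpos _ (ha1 θ hθ)) hk0).ne' (by
      filter_upwards [isOpen_Ioo.mem_nhds hθ] with y hy
      rw [ha2 y hy]; field_simp)
  rwa [inv_div] at this

/-- **Prékopa–Leindler inequality** on the line for positive continuous densities on bounded
intervals; in the case of equality the normalized densities are translates of each other. -/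
theorem prekopa_leindler_Ioo {f g : ℝ → ℝ} {h : ℝ → ENNReal} {α β γ δ k l w : ℝ}
    (hw0 : 0 < w) (hw1 : w < 1)
    (hαβ : α < β) (hf : ContinuousOn f (Ioo α β)) (hfpos : ∀ s ∈ Ioo α β, 0 < f s)
    (hfint : IntegrableOn f (Ioo α β)) (hk : ∫ s in Ioo α β, f s = k) (hk0 : 0 < k)
    (hγδ : γ < δ) (hg : ContinuousOn g (Ioo γ δ)) (hgpos : ∀ s ∈ Ioo γ δ, 0 < g s)
    (hgint : IntegrableOn g (Ioo γ δ)) (hl : ∫ s in Ioo γ δ, g s = l) (hl0 : 0 < l)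
    (hh : ∀ s ∈ Ioo α β, ∀ t ∈ Ioo γ δ,
      ENNReal.ofReal (f s ^ (1 - w) * g t ^ w) ≤ h ((1 - w) * s + w * t)) :
    ENNReal.ofReal (k ^ (1 - w) * l ^ w) ≤ ∫⁻ s, h s ∧
    (∫⁻ s, h s ≤ ENNReal.ofReal (k ^ (1 - w) * l ^ w) →
      ∃ c, α = γ + c ∧ β = δ + c ∧ ∀ s ∈ Ioo α β, f s / k = g (s - c) / l) := by
  obtain ⟨a, ha, haim, ham⟩ := exists_quantile hαβ hf hfpos hfint hk
  obtain ⟨b, hb, hbim, hbm⟩ := exists_quantile hγδ hg hgpos hgint hl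
  have hw1' : 0 < 1 - w := by linarith
  -- In the substitution `s = (1 - w) * a θ + w * b θ` by quantile functions, `W` is the Jacobian
  -- times the lower bound for `h`. Bounding the Jacobian by AM-GM cancels the densities and leaves
  -- the constant `k ^ (1 - w) * l ^ w`.
  set W : ℝ → ℝ := fun θ => ((1 - w) * (k / f (a θ)) + w * (l / g (b θ))) *
    (f (a θ) ^ (1 - w) * g (b θ) ^ w) with hW
  have hfa : ∀ θ ∈ Ioo (0 : ℝ) 1, 0 < f (a θ) := fun θ hθ => hfpos _ (ha θ hθ).1
  have hgb : ∀ θ ∈ Ioo (0 : ℝ) 1, 0 < g (b θ) := fun θ hθ => hgpos _ (hb θ hθ).1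
  have hid : ∀ θ ∈ Ioo (0 : ℝ) 1, k ^ (1 - w) * l ^ w =
      ((k / f (a θ)) ^ (1 - w) * (l / g (b θ)) ^ w) * (f (a θ) ^ (1 - w) * g (b θ) ^ w) := by
    intro θ hθ
    have h1 := hfa θ hθ
    have h2 := hgb θ hθ
    rw [Real.div_rpow hk0.le h1.le, Real.div_rpow hl0.le h2.le]
    have := (Real.rpow_pos_of_pos h1 (1 - w)).ne'
    have := (Real.rpow_pos_of_pos h2 w).ne'
    field_simp
  have hWge : ∀ θ ∈ Ioo (0 : ℝ) 1, k ^ (1 - w) * l ^ w ≤ W θ := by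
    intro θ hθ
    have h1 := hfa θ hθ
    have h2 := hgb θ hθ
    rw [hid θ hθ]
    apply mul_le_mul_of_nonneg_right _ (by positivity)
    exact Real.geom_mean_le_arith_mean2_weighted hw1'.le hw0.le (by positivity) (by positivity)
      (by ring)
  set c : ℝ → ℝ := fun θ => (1 - w) * a θ + w * b θ with hc
  have hcm : StrictMonoOn c (Ioo 0 1) := by
    intro x hx y hy hxy
    have h1 := ham hx hy hxy
    have h2 := hbm hx hy hxy
    simp only [hc]
    gcongr
  have hcd : ∀ θ ∈ Ioo (0 : ℝ) 1,
      HasDerivAt c ((1 - w) * (k / f (a θ)) + w * (l / g (b θ))) θ := fun θ hθ =>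
    ((ha θ hθ).2.const_mul _).add ((hb θ hθ).2.const_mul _)
  have hkey : ∫⁻ θ in Ioo (0 : ℝ) 1, ENNReal.ofReal (W θ) ≤ ∫⁻ s, h s := by
    calc ∫⁻ θ in Ioo (0 : ℝ) 1, ENNReal.ofReal (W θ)
        ≤ ∫⁻ θ in Ioo (0 : ℝ) 1,
          ENNReal.ofReal |(1 - w) * (k / f (a θ)) + w * (l / g (b θ))| * h (c θ) := by
          apply setLIntegral_mono' measurableSet_Ioo
          intro θ hθ
          have h1 := hfa θ hθ
          have h2 := hgb θ hθ
          have h3 : 0 ≤ (1 - w) * (k / f (a θ)) + w * (l / g (b θ)) := by positivity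
          rw [abs_of_nonneg h3, hW, ENNReal.ofReal_mul h3]
          gcongr
          exact hh _ (ha θ hθ).1 _ (hb θ hθ).1
      _ = ∫⁻ s in c '' Ioo 0 1, h s :=
          (lintegral_image_eq_lintegral_abs_deriv_mul measurableSet_Ioo
            (fun θ hθ => (hcd θ hθ).hasDerivWithinAt) hcm.injOn h).symm
      _ ≤ ∫⁻ s, h s := setLIntegral_le_lintegral _ _
  have hone : ∫⁻ _ in Ioo (0 : ℝ) 1, ENNReal.ofReal (k ^ (1 - w) * l ^ w) =
      ENNReal.ofReal (k ^ (1 - w) * l ^ w) := by simp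
  have hle : ∫⁻ _ in Ioo (0 : ℝ) 1, ENNReal.ofReal (k ^ (1 - w) * l ^ w) ≤
      ∫⁻ θ in Ioo (0 : ℝ) 1, ENNReal.ofReal (W θ) :=
    setLIntegral_mono' measurableSet_Ioo fun θ hθ => ENNReal.ofReal_le_ofReal (hWge θ hθ)
  refine ⟨hone ▸ hle.trans hkey, fun hup => ?_⟩
  have hac : ContinuousOn a (Ioo 0 1) := fun θ hθ => (ha θ hθ).2.continuousAt.continuousWithinAt
  have hbc : ContinuousOn b (Ioo 0 1) := fun θ hθ => (hb θ hθ).2.continuousAt.continuousWithinAt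
  have hfac : ContinuousOn (fun θ => f (a θ)) (Ioo 0 1) := hf.comp hac fun θ hθ => (ha θ hθ).1
  have hgbc : ContinuousOn (fun θ => g (b θ)) (Ioo 0 1) := hg.comp hbc fun θ hθ => (hb θ hθ).1
  have hWc : ContinuousOn W (Ioo 0 1) := by
    apply ContinuousOn.mul
    · exact (continuousOn_const.mul (continuousOn_const.div hfac fun θ hθ => (hfa θ hθ).ne')).add
        (continuousOn_const.mul (continuousOn_const.div hgbc fun θ hθ => (hgb θ hθ).ne'))
    · exact (hfac.rpow_const fun θ hθ => Or.inl (hfa θ hθ).ne').mul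
        (hgbc.rpow_const fun θ hθ => Or.inl (hgb θ hθ).ne')
  have hae := ae_eq_of_ae_le_of_lintegral_le
    (μ := volume.restrict (Ioo (0 : ℝ) 1)) (f := fun _ => ENNReal.ofReal (k ^ (1 - w) * l ^ w))
    (g := fun θ => ENNReal.ofReal (W θ))
    (ae_restrict_of_forall_mem measurableSet_Ioo
      fun θ hθ => ENNReal.ofReal_le_ofReal (hWge θ hθ)) (by rw [hone]; exact ENNReal.ofReal_ne_top)
    (hWc.aemeasurable measurableSet_Ioo).ennreal_ofReal
    (by rw [hone]; exact hkey.trans hup)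
  -- Continuity upgrades almost everywhere equality to equality at every `θ`. Equality in AM-GM then
  -- says that `a` and `b` have the same derivative, so they differ by a constant.
  have heq : ∀ θ ∈ Ioo (0 : ℝ) 1, k / f (a θ) = l / g (b θ) := by
    have hEq := Measure.eqOn_open_of_ae_eq hae isOpen_Ioo continuousOn_const
      (ENNReal.continuous_ofReal.comp_continuousOn hWc)
    intro θ hθ
    have h1 := hfa θ hθ
    have h2 := hgb θ hθ
    have h3 : W θ = k ^ (1 - w) * l ^ w := by
      have := hEq hθ
      simp only at this
      rw [ENNReal.ofReal_eq_ofReal_iff (by positivity)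
        ((by positivity : (0 : ℝ) ≤ k ^ (1 - w) * l ^ w).trans (hWge θ hθ))] at this
      exact this.symm
    rw [hid θ hθ] at h3
    refine eq_of_geom_mean_eq_arith_mean hw0 hw1 (by positivity) (by positivity) ?_
    exact (mul_right_cancel₀ (by positivity) h3).symm
  have hd : ∀ θ ∈ Ioo (0 : ℝ) 1, HasDerivAt (fun θ => a θ - b θ) 0 θ := by
    intro θ hθ
    have := (ha θ hθ).2.sub (hb θ hθ).2
    rwa [heq θ hθ, sub_self] at this
  have hhalf : (1 / 2 : ℝ) ∈ Ioo (0 : ℝ) 1 := by norm_num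
  have hconst : ∀ θ ∈ Ioo (0 : ℝ) 1, a θ - b θ = a (1 / 2) - b (1 / 2) := fun θ hθ =>
    isOpen_Ioo.is_const_of_deriv_eq_zero (f := fun θ => a θ - b θ) isPreconnected_Ioo
      (fun x hx => (hd x hx).differentiableAt.differentiableWithinAt)
      (fun x hx => (hd x hx).deriv) hθ hhalf
  set e := a (1 / 2) - b (1 / 2)
  have hio : Ioo α β = Ioo (γ + e) (δ + e) := by
    rw [← image_add_const_Ioo, ← hbim, ← haim, image_image]
    apply image_congr
    intro θ hθ
    linarith [hconst θ hθ]
  have hαγ : α = γ + e := by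
    rw [← csInf_Ioo hαβ, hio, csInf_Ioo (by linarith)]
  have hβδ : β = δ + e := by
    rw [← csSup_Ioo hαβ, hio, csSup_Ioo (by linarith)]
  refine ⟨e, hαγ, hβδ, ?_⟩
  intro s hs
  rw [← haim] at hs
  obtain ⟨θ, hθ, rfl⟩ := hs
  have h1 := heq θ hθ
  have h2 : a θ - e = b θ := by linarith [hconst θ hθ]
  rw [h2, ← inv_div, h1, inv_div]

/-! ### The Brunn–Minkowski inequality for convex bodies -/

/-- The multiplicative Brunn–Minkowski inequality for compact convex sets and the measure `μ`. -/
def LogBrunnMinkowski {F : Type*} [AddCommGroup F] [Module ℝ F] [TopologicalSpace F]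
    [MeasurableSpace F] (μ : Measure F) : Prop :=
  ∀ ⦃K L : Set F⦄, IsCompact K → Convex ℝ K → K.Nonempty → IsCompact L → Convex ℝ L →
    L.Nonempty → ∀ ⦃w : ℝ⦄, 0 < w → w < 1 →
      μ.real K ^ (1 - w) * μ.real L ^ w ≤ μ.real ((1 - w) • K + w • L)

/-! ### Slices of convex bodies in a product with the line -/

section Sections

variable {G : Type*} [NormedAddCommGroup G]

lemma isCompact_section {K : Set (ℝ × G)} (hK : IsCompact K) (s : ℝ) :
    IsCompact (Prod.mk s ⁻¹' K) := by
  have h := (Topology.IsClosedEmbedding.of_continuous_injective_isClosedMap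
    (f := (Prod.mk s : G → ℝ × G)) (by fun_prop) (Prod.mk_right_injective s)
    (isClosedMap_prodMk_left s))
  exact h.isCompact_preimage hK

variable [NormedSpace ℝ G]

lemma convex_section {K : Set (ℝ × G)} (hK : Convex ℝ K) (s : ℝ) :
    Convex ℝ (Prod.mk s ⁻¹' K) := by
  intro x hx y hy a b ha hb hab
  have := hK hx hy ha hb hab
  simp only [Prod.smul_mk, Prod.mk_add_mk, smul_eq_mul, ← add_mul, hab, one_mul] at this
  exact this

lemma smul_section_add_smul_section_subset (K L : Set (ℝ × G)) (a b s t : ℝ) :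
    a • (Prod.mk s ⁻¹' K) + b • (Prod.mk t ⁻¹' L) ⊆
      Prod.mk (a * s + b * t) ⁻¹' (a • K + b • L) := by
  rintro _ ⟨_, ⟨x, hx, rfl⟩, _, ⟨y, hy, rfl⟩, rfl⟩
  exact ⟨_, ⟨_, hx, rfl⟩, _, ⟨_, hy, rfl⟩, by simp⟩

/-- The first coordinates of a convex body form an interval, and over its interior points there
are interior points of the body. -/
lemma exists_image_fst_eq_Icc {K : Set (ℝ × G)} (hKc : IsCompact K) (hK : Convex ℝ K)
    (hKi : (interior K).Nonempty) :
    ∃ α β, α < β ∧ Prod.fst '' K = Icc α β ∧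
      ∀ s ∈ Ioo α β, ∃ y, (s, y) ∈ interior K := by
  have hne : K.Nonempty := hKi.mono interior_subset
  have hconn : IsConnected (Prod.fst '' K) :=
    (hK.isConnected hne).image _ continuous_fst.continuousOn
  have hI := eq_Icc_of_connected_compact hconn (hKc.image continuous_fst)
  set α := sInf (Prod.fst '' K)
  set β := sSup (Prod.fst '' K)
  have hUo : IsOpen (Prod.fst '' interior K) := isOpenMap_fst _ isOpen_interior
  have hUc : Convex ℝ (Prod.fst '' interior K) :=
    hK.interior.linear_image (LinearMap.fst ℝ ℝ G)
  have hUne : (Prod.fst '' interior K).Nonempty := hKi.image _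
  have hsub : Icc α β ⊆ closure (Prod.fst '' interior K) := by
    rw [← hI]
    refine Subset.trans (image_mono ?_) (image_closure_subset_closure_image continuous_fst)
    exact (hK.closure_interior_eq_closure_of_nonempty_interior hKi).symm ▸ subset_closure
  have hIoo : Ioo α β ⊆ Prod.fst '' interior K := by
    have := interior_mono hsub
    rwa [hUc.interior_closure_eq_interior_of_nonempty_interior (by rwa [hUo.interior_eq]),
      hUo.interior_eq, interior_Icc] at this
  refine ⟨α, β, ?_, hI, fun s hs => ?_⟩
  · have h1 : Prod.fst '' interior K ⊆ Ioo α β := by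
      rw [← interior_Icc, ← hI]
      exact interior_maximal (image_mono interior_subset) hUo
    obtain ⟨x, hx⟩ := hUne
    exact (h1 hx).1.trans (h1 hx).2
  · obtain ⟨⟨_, y⟩, hy, rfl⟩ := hIoo hs
    exact ⟨y, hy⟩

variable [FiniteDimensional ℝ G] [MeasurableSpace G] [BorelSpace G]
  (ν : Measure G) [ν.IsAddHaarMeasure]

/-- Integration over a convex body by sections; the section function is positive and continuous
inside its support. -/
lemma exists_section_density (hν : LogBrunnMinkowski ν) {K : Set (ℝ × G)} (hKc : IsCompact K)
    (hK : Convex ℝ K) (hKi : (interior K).Nonempty) :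
    ∃ α β, α < β ∧ Prod.fst '' K = Icc α β ∧
      ContinuousOn (fun s => ν.real (Prod.mk s ⁻¹' K)) (Ioo α β) ∧
      (∀ s ∈ Ioo α β, 0 < ν.real (Prod.mk s ⁻¹' K)) ∧
      ∀ φ : ℝ → ℝ, Continuous φ →
        IntegrableOn (fun s => φ s * ν.real (Prod.mk s ⁻¹' K)) (Ioo α β) ∧
        ∫ s in Ioo α β, φ s * ν.real (Prod.mk s ⁻¹' K) =
          ∫ z in K, φ z.1 ∂((volume : Measure ℝ).prod ν) := by
  obtain ⟨α, β, hαβ, hI, hint⟩ := exists_image_fst_eq_Icc hKc hK hKi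
  have hsec : ∀ s, MeasurableSet (Prod.mk s ⁻¹' K) := fun s =>
    (isCompact_section hKc s).measurableSet
  have hfin : ∀ s, ν (Prod.mk s ⁻¹' K) ≠ ⊤ := fun s => (isCompact_section hKc s).measure_ne_top
  have hne : ∀ s ∈ Ioo α β, (Prod.mk s ⁻¹' K).Nonempty := fun s hs => by
    obtain ⟨y, hy⟩ := hint s hs
    exact ⟨y, (interior_subset hy : (s, y) ∈ K)⟩
  have hpos : ∀ s ∈ Ioo α β, 0 < ν.real (Prod.mk s ⁻¹' K) := by
    intro s hs
    obtain ⟨y, hy⟩ := hint s hs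
    refine ENNReal.toReal_pos ?_ (hfin s)
    have h1 : Prod.mk s ⁻¹' interior K ⊆ Prod.mk s ⁻¹' K := preimage_mono interior_subset
    have h2 : IsOpen (Prod.mk s ⁻¹' interior K) := isOpen_interior.preimage (by fun_prop)
    exact (lt_of_lt_of_le (h2.measure_pos ν ⟨y, hy⟩) (measure_mono h1)).ne'
  refine ⟨α, β, hαβ, hI, ?_, hpos, ?_⟩
  -- Brunn–Minkowski for the slices makes the section function log-concave, and concave functions
  -- are continuous on open intervals.
  · have hconc : ConcaveOn ℝ (Ioo α β) fun s => Real.log (ν.real (Prod.mk s ⁻¹' K)) := by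
      refine ⟨convex_Ioo _ _, ?_⟩
      intro s hs t ht a b ha hb hab
      rcases ha.eq_or_lt with rfl | ha
      · obtain rfl : b = 1 := by linarith
        simp
      rcases hb.eq_or_lt with rfl | hb
      · obtain rfl : a = 1 := by linarith
        simp
      obtain rfl : a = 1 - b := by linarith
      have h1 := hν (isCompact_section hKc s) (convex_section hK s) (hne s hs)
        (isCompact_section hKc t) (convex_section hK t) (hne t ht) hb (by linarith)
      have h2 := smul_section_add_smul_section_subset K K (1 - b) b s t
      have h3 : (1 - b) • K + b • K ⊆ K := by
        rw [← hK.add_smul ha.le hb.le]; simp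
      have h4 := h1.trans (measureReal_mono (h2.trans (preimage_mono h3)) (hfin _))
      simp only [smul_eq_mul]
      have p1 := hpos s hs
      have p2 := hpos t ht
      rw [← Real.log_rpow p1, ← Real.log_rpow p2, ← Real.log_mul (by positivity) (by positivity)]
      exact Real.log_le_log (by positivity) h4
    refine (Real.continuous_exp.comp_continuousOn (hconc.continuousOn isOpen_Ioo)).congr ?_
    intro s hs
    simp [Real.exp_log (hpos s hs)]
  · intro φ hφ
    have hmeas := hKc.measurableSet
    have hi : Integrable (K.indicator fun z => φ z.1) ((volume : Measure ℝ).prod ν) := by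
      rw [integrable_indicator_iff hmeas]
      exact (hφ.comp continuous_fst).continuousOn.integrableOn_compact hKc
    have hinner : ∀ s, ∫ y, K.indicator (fun z => φ z.1) (s, y) ∂ν =
        φ s * ν.real (Prod.mk s ⁻¹' K) := by
      intro s
      have : (fun y => K.indicator (fun z => φ z.1) (s, y)) =
          (Prod.mk s ⁻¹' K).indicator fun _ => φ s := by
        rfl
      rw [this, integral_indicator (hsec s)]
      simp [mul_comm]
    have hI1 := hi.integral_prod_left
    simp only [hinner] at hI1
    refine ⟨hI1.integrableOn, ?_⟩
    rw [← integral_indicator hmeas, integral_prod _ hi]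
    simp only [hinner]
    rw [← integral_Icc_eq_integral_Ioo]
    apply setIntegral_eq_integral_of_forall_compl_eq_zero
    intro s hs
    have : Prod.mk s ⁻¹' K = ∅ := by
      ext y
      simp only [mem_preimage, mem_empty_iff_false, iff_false]
      intro hy
      exact hs (hI ▸ ⟨_, hy, rfl⟩)
    simp [this]

/-- The inductive step for the Brunn–Minkowski inequality, with the information contained in the
case of equality. -/
theorem logBrunnMinkowski_prod (hν : LogBrunnMinkowski ν) {K L : Set (ℝ × G)}
    (hKc : IsCompact K) (hK : Convex ℝ K) (hKi : (interior K).Nonempty)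
    (hLc : IsCompact L) (hL : Convex ℝ L) (hLi : (interior L).Nonempty)
    {w : ℝ} (hw0 : 0 < w) (hw1 : w < 1) {μ : Measure (ℝ × G)}
    (hμ : μ = (volume : Measure ℝ).prod ν) :
    μ.real K ^ (1 - w) * μ.real L ^ w ≤ μ.real ((1 - w) • K + w • L) ∧
    (μ.real ((1 - w) • K + w • L) ≤ μ.real K ^ (1 - w) * μ.real L ^ w →
      sSup (Prod.fst '' K) - sSup (Prod.fst '' L) =
        (∫ z in K, z.1 ∂μ) / μ.real K - (∫ z in L, z.1 ∂μ) / μ.real L) := by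
  obtain ⟨α, β, hαβ, hKI, hfc, hfpos, hfφ⟩ := exists_section_density ν hν hKc hK hKi
  obtain ⟨γ, δ, hγδ, hLI, hgc, hgpos, hgφ⟩ := exists_section_density ν hν hLc hL hLi
  rw [← hμ] at hfφ hgφ
  have hμhaar : μ.IsAddHaarMeasure := hμ ▸ inferInstance
  have hf1 := hfφ (fun _ => 1) continuous_const
  have hg1 := hgφ (fun _ => 1) continuous_const
  simp only [one_mul, setIntegral_const, smul_eq_mul, mul_one] at hf1 hg1
  have hk0 : 0 < μ.real K := ENNReal.toReal_pos
    (Measure.measure_pos_of_nonempty_interior μ hKi).ne' hKc.measure_ne_top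
  have hl0 : 0 < μ.real L := ENNReal.toReal_pos
    (Measure.measure_pos_of_nonempty_interior μ hLi).ne' hLc.measure_ne_top
  have hMc : IsCompact ((1 - w) • K + w • L) := (hKc.smul _).add (hLc.smul _)
  have hne : ∀ {M : Set (ℝ × G)} {a b : ℝ}, Prod.fst '' M = Icc a b → ∀ s ∈ Ioo a b,
      (Prod.mk s ⁻¹' M).Nonempty := by
    intro M a b h s hs
    obtain ⟨⟨_, y⟩, hy, rfl⟩ := h.symm ▸ Ioo_subset_Icc_self hs
    exact ⟨y, hy⟩
  have hM : ∫⁻ s, ν (Prod.mk s ⁻¹' ((1 - w) • K + w • L)) = μ ((1 - w) • K + w • L) := by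
    rw [hμ, Measure.prod_apply hMc.measurableSet]
  have hPL := prekopa_leindler_Ioo hw0 hw1 hαβ hfc hfpos hf1.1 hf1.2 hk0 hγδ hgc hgpos hg1.1
    hg1.2 hl0 (h := fun s => ν (Prod.mk s ⁻¹' ((1 - w) • K + w • L))) (by
      intro s hs t ht
      have h1 := hν (isCompact_section hKc s) (convex_section hK s) (hne hKI s hs)
        (isCompact_section hLc t) (convex_section hL t) (hne hLI t ht) hw0 hw1
      refine (ENNReal.ofReal_le_ofReal h1).trans ?_
      rw [ofReal_measureReal (((isCompact_section hKc s).smul _).add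
        ((isCompact_section hLc t).smul _)).measure_ne_top]
      exact measure_mono (smul_section_add_smul_section_subset K L (1 - w) w s t))
  rw [hM] at hPL
  refine ⟨(ENNReal.ofReal_le_iff_le_toReal hMc.measure_ne_top).1 hPL.1, fun hup => ?_⟩
  obtain ⟨c, hc1, hc2, hc3⟩ := hPL.2
    ((ENNReal.le_ofReal_iff_toReal_le hMc.measure_ne_top (by positivity)).2 hup)
  -- The normalized section functions are translates by `c`, so the right endpoint and the mean of
  -- the first coordinate both shift by `c`; eliminating `c` gives the identity.
  have hf2 := hfφ (fun s => s) continuous_id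
  have hg2 := hgφ (fun s => s) continuous_id
  rw [hKI, hLI, csSup_Icc hαβ.le, csSup_Icc hγδ.le, ← hf2.2, ← hg2.2, ← integral_div, ← integral_div]
  have e1 : ∫ s in Ioo α β, s * ν.real (Prod.mk s ⁻¹' K) / μ.real K =
      ∫ s in Ioo γ δ, (s + c) * (ν.real (Prod.mk s ⁻¹' L) / μ.real L) := by
    have himg : (fun x => x + c) ⁻¹' Ioo α β = Ioo γ δ := by
      rw [hc1, hc2]; simp
    have e0 := (measurePreserving_add_right volume c).setIntegral_preimage_emb
      (measurableEmbedding_addRight c)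
      (fun s => s * (ν.real (Prod.mk (s - c) ⁻¹' L) / μ.real L)) (Ioo α β)
    simp only [himg, add_sub_cancel_right] at e0
    rw [e0]
    exact setIntegral_congr_fun measurableSet_Ioo fun s hs => by
      simp only [mul_div_assoc, hc3 s hs]
  rw [e1]
  have e2 : ∫ s in Ioo γ δ, (s + c) * (ν.real (Prod.mk s ⁻¹' L) / μ.real L) =
      (∫ s in Ioo γ δ, s * ν.real (Prod.mk s ⁻¹' L) / μ.real L) + c := by
    have e3 : ∫ s in Ioo γ δ, c * (ν.real (Prod.mk s ⁻¹' L) / μ.real L) = c := by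
      rw [integral_const_mul, integral_div, hg1.2, div_self hl0.ne', mul_one]
    conv_rhs => rw [← e3]
    rw [← integral_add (hg2.1.div_const _) ((hg1.1.div_const _).const_mul _)]
    congr 1
    ext s
    ring
  rw [e2, hc2]
  ring

end Sections

lemma measureReal_pos_of_interior {F : Type*} [TopologicalSpace F] [AddGroup F]
    [MeasurableSpace F] (μ : Measure F) [μ.IsAddHaarMeasure] {K : Set F}
    (hK : IsCompact K) (h : (interior K).Nonempty) : 0 < μ.real K :=
  ENNReal.toReal_pos (Measure.measure_pos_of_nonempty_interior μ h).ne' hK.measure_ne_top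

/-! ### Support functions and Brunn–Minkowski by slicing along functionals -/

section BrunnMinkowski

variable {F : Type*} [NormedAddCommGroup F] [NormedSpace ℝ F]

/-- The support function of a set, as a function on the dual space. -/
def suppFn (K : Set F) (u : F →L[ℝ] ℝ) : ℝ := sSup (u '' K)

lemma le_suppFn {K : Set F} (hK : IsCompact K) (u : F →L[ℝ] ℝ) {x : F} (hx : x ∈ K) :
    u x ≤ suppFn K u :=
  le_csSup (hK.image u.continuous).bddAbove ⟨x, hx, rfl⟩

lemma exists_suppFn_eq {K : Set F} (hK : IsCompact K) (hne : K.Nonempty) (u : F →L[ℝ] ℝ) :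
    ∃ x ∈ K, suppFn K u = u x := by
  obtain ⟨x, hx, h⟩ := (hK.image u.continuous).sSup_mem (hne.image u)
  exact ⟨x, hx, h.symm⟩

lemma suppFn_image {E' : Type*} [NormedAddCommGroup E'] [NormedSpace ℝ E'] (A : E' →L[ℝ] F)
    (K : Set E') (u : F →L[ℝ] ℝ) : suppFn (A '' K) u = suppFn K (u.comp A) := by
  rw [suppFn, image_image]; rfl

lemma suppFn_smul {c : ℝ} (hc : 0 ≤ c) (K : Set F) (u : F →L[ℝ] ℝ) :
    suppFn (c • K) u = c * suppFn K u := by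
  rw [suppFn, image_smul_set, Real.sSup_smul_of_nonneg hc, suppFn, smul_eq_mul]

/-- A compact convex set is determined by its support function. -/
lemma subset_of_suppFn_le {K L : Set F} (hK : IsCompact K) (hL : IsCompact L) (hLc : Convex ℝ L)
    (hne : L.Nonempty) (h : ∀ u, suppFn K u ≤ suppFn L u) : K ⊆ L := by
  intro x hx
  by_contra hxL
  obtain ⟨f, r, h1, h2⟩ := geometric_hahn_banach_closed_point hLc hL.isClosed hxL
  obtain ⟨y, hy, hye⟩ := exists_suppFn_eq hL hne f
  linarith [h f, le_suppFn hK f hx, h1 y hy]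

variable [FiniteDimensional ℝ F] [MeasurableSpace F] [BorelSpace F]

/-- Disintegration of a Haar measure along a linear functional. -/
lemma exists_slicing (μ : Measure F) [μ.IsAddHaarMeasure] {u : F →L[ℝ] ℝ} (hu : u ≠ 0) :
    ∃ (e : F ≃L[ℝ] ℝ × u.ker) (ν : Measure u.ker), ν.IsAddHaarMeasure ∧
      (∀ x, (e x).1 = u x) ∧ μ.map e = (volume : Measure ℝ).prod ν := by
  obtain ⟨x, hx⟩ : ∃ x, u x ≠ 0 := by
    by_contra! h
    exact hu (by ext x; simpa using h x)
  let v : ℝ →L[ℝ] F := ContinuousLinearMap.toSpanSingleton ℝ ((u x)⁻¹ • x)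
  have hv : Function.RightInverse v u := by
    intro t; simp [v, hx]
  let e := ContinuousLinearEquiv.equivOfRightInverse u v hv
  -- Any Haar measure on the kernel works up to a factor, by uniqueness of Haar measure on the
  -- product; the factor is absorbed into `ν`.
  let ν₀ : Measure u.ker := Measure.addHaar
  have : (μ.map e).IsAddHaarMeasure := e.isAddHaarMeasure_map μ
  have h := Measure.isAddLeftInvariant_eq_smul (μ.map e) ((volume : Measure ℝ).prod ν₀)
  set c := Measure.addHaarScalarFactor (μ.map e) ((volume : Measure ℝ).prod ν₀) with hc
  have hc0 : 0 < c := Measure.addHaarScalarFactor_pos_of_isAddHaarMeasure _ _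
  refine ⟨e, (c : ENNReal) • ν₀, Measure.IsAddHaarMeasure.smul _
    (by exact_mod_cast hc0.ne') ENNReal.coe_ne_top, fun x => rfl, ?_⟩
  rw [h, Measure.prod_smul_right]
  rfl

lemma interior_nonempty_of_measure_pos (μ : Measure F) [μ.IsAddHaarMeasure] {K : Set F}
    (hK : Convex ℝ K) (h : μ K ≠ 0) : (interior K).Nonempty := by
  by_contra hne
  rw [not_nonempty_iff_eq_empty] at hne
  apply h
  refine measure_mono_null ?_ (hK.addHaar_frontier μ)
  rw [frontier, hne, sdiff_empty]
  exact subset_closure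

/-- This transports `logBrunnMinkowski_prod` to an arbitrary direction `u`. The right-hand side of
the equality conclusion is `u` applied to the difference of the centroids, hence linear in `u`. -/
lemma logBrunnMinkowski_slicing (μ : Measure F) [μ.IsAddHaarMeasure] {u : F →L[ℝ] ℝ}
    (hu : u ≠ 0) (hker : ∀ ν : Measure u.ker, ν.IsAddHaarMeasure → LogBrunnMinkowski ν)
    {K L : Set F}
    (hKc : IsCompact K) (hK : Convex ℝ K) (hKi : (interior K).Nonempty)
    (hLc : IsCompact L) (hL : Convex ℝ L) (hLi : (interior L).Nonempty)
    {w : ℝ} (hw0 : 0 < w) (hw1 : w < 1) :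
    μ.real K ^ (1 - w) * μ.real L ^ w ≤ μ.real ((1 - w) • K + w • L) ∧
    (μ.real ((1 - w) • K + w • L) ≤ μ.real K ^ (1 - w) * μ.real L ^ w →
      suppFn K u - suppFn L u =
        (∫ x in K, u x ∂μ) / μ.real K - (∫ x in L, u x ∂μ) / μ.real L) := by
  obtain ⟨e, ν, hν, heu, hmap⟩ := exists_slicing μ hu
  have hemb : MeasurableEmbedding e := e.toHomeomorph.measurableEmbedding
  have hreal : ∀ M : Set F, (μ.map e).real (e '' M) = μ.real M := by
    intro M
    rw [Measure.real, Measure.real, hemb.map_apply]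
    rw [e.injective.preimage_image M]
  have hint : ∀ M : Set F, ∫ z in e '' M, z.1 ∂(μ.map e) = ∫ x in M, u x ∂μ := by
    intro M
    rw [hemb.setIntegral_map, e.injective.preimage_image M]
    simp [heu]
  have hsup : ∀ M : Set F, sSup (Prod.fst '' (e '' M)) = suppFn M u := by
    intro M
    rw [image_image, suppFn]
    simp only [heu]
  have hinte : ∀ {M : Set F}, (interior M).Nonempty → (interior (e '' M)).Nonempty := by
    intro M h
    have : interior (e '' M) = e '' interior M := (e.toHomeomorph.image_interior M).symm
    rw [this]
    exact h.image _
  have h := logBrunnMinkowski_prod ν (hker ν hν) (hKc.image e.continuous)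
    (hK.linear_image e.toLinearMap) (hinte hKi) (hLc.image e.continuous)
    (hL.linear_image e.toLinearMap) (hinte hLi) hw0 hw1 hmap
  have hM : (1 - w) • (e '' K) + w • (e '' L) = e '' ((1 - w) • K + w • L) := by
    rw [image_add, image_smul_set, image_smul_set]
  simpa only [hM, hreal, hint, hsup] using h

/-- **Brunn–Minkowski inequality**, multiplicative form. -/
theorem logBrunnMinkowski (μ : Measure F) [μ.IsAddHaarMeasure] : LogBrunnMinkowski μ := by
  obtain ⟨d, hd⟩ : ∃ d, Module.finrank ℝ F = d := ⟨_, rfl⟩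
  induction d generalizing F with
  | zero =>
    intro K L hKc hK hKn hLc hL hLn w hw0 hw1
    have : Subsingleton F := Module.finrank_zero_iff.1 hd
    have h : ∀ M : Set F, M.Nonempty → M = univ := fun M hM => Subsingleton.eq_univ_of_nonempty hM
    rw [h K hKn, h L hLn, h _ ((univ_nonempty.smul_set).add (univ_nonempty.smul_set))]
    have hp : 0 < μ.real univ :=
      measureReal_pos_of_interior μ (Set.subsingleton_univ.isCompact) (by simp)
    rw [← Real.rpow_add hp]
    simp
  | succ d ih =>
    intro K L hKc hK hKn hLc hL hLn w hw0 hw1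
    by_cases hK0 : μ K = 0
    · rw [Measure.real, hK0, ENNReal.toReal_zero, Real.zero_rpow (by linarith), zero_mul]
      exact measureReal_nonneg
    by_cases hL0 : μ L = 0
    · rw [Measure.real, Measure.real, hL0, ENNReal.toReal_zero, Real.zero_rpow hw0.ne', mul_zero]
      exact measureReal_nonneg
    have : Nontrivial F := Module.nontrivial_of_finrank_pos (R := ℝ) (by omega)
    obtain ⟨x, hx⟩ := exists_ne (0 : F)
    obtain ⟨u, hu⟩ := SeparatingDual.exists_ne_zero (R := ℝ) hx
    have hu0 : u ≠ 0 := fun h => hu (by simp [h])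
    refine (logBrunnMinkowski_slicing μ hu0 (fun ν hν => ih ν ?_) hKc hK
      (interior_nonempty_of_measure_pos μ hK hK0) hLc hL
      (interior_nonempty_of_measure_pos μ hL hL0) hw0 hw1).1
    have h1 := Module.Dual.finrank_ker_add_one_of_ne_zero (f := (u : F →ₗ[ℝ] ℝ)) (fun h => hu (by
      simpa using congrArg (fun f : F →ₗ[ℝ] ℝ => f x) h))
    omega

/-- Equality in the multiplicative Brunn–Minkowski inequality forces the bodies to be translates. -/
theorem exists_suppFn_eq_add_of_measureReal_le (μ : Measure F) [μ.IsAddHaarMeasure] {K L : Set F}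
    (hKc : IsCompact K) (hK : Convex ℝ K) (hKi : (interior K).Nonempty)
    (hLc : IsCompact L) (hL : Convex ℝ L) (hLi : (interior L).Nonempty)
    {w : ℝ} (hw0 : 0 < w) (hw1 : w < 1)
    (h : μ.real ((1 - w) • K + w • L) ≤ μ.real K ^ (1 - w) * μ.real L ^ w) :
    ∃ t : F, ∀ u : F →L[ℝ] ℝ, suppFn K u = suppFn L u + u t := by
  -- The translation is the difference of the centroids, which does not depend on `u`.
  refine ⟨(μ.real K)⁻¹ • (∫ x in K, x ∂μ) - (μ.real L)⁻¹ • ∫ x in L, x ∂μ, fun u => ?_⟩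
  by_cases hu : u = 0
  · subst hu
    have : ∀ M : Set F, (interior M).Nonempty → suppFn M (0 : F →L[ℝ] ℝ) = 0 := by
      intro M hM
      simp [suppFn, (hM.mono interior_subset).image_const]
    simp [this K hKi, this L hLi]
  have h1 := (logBrunnMinkowski_slicing μ hu (fun ν _ => logBrunnMinkowski ν) hKc hK hKi hLc hL
    hLi hw0 hw1).2 h
  have hint : ∀ M : Set F, IsCompact M → ∫ x in M, u x ∂μ = u (∫ x in M, x ∂μ) := fun M hM =>
    u.integral_comp_comm (continuous_id.continuousOn.integrableOn_compact hM)
  rw [hint K hKc, hint L hLc] at h1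
  simp only [map_sub, map_smul, smul_eq_mul]
  linear_combination h1

lemma measureReal_smul (μ : Measure F) [μ.IsAddHaarMeasure] {c : ℝ} (hc : 0 ≤ c) (K : Set F) :
    μ.real (c • K) = c ^ Module.finrank ℝ F * μ.real K := by
  rw [Measure.real, Measure.addHaar_smul, ENNReal.toReal_mul,
    ENNReal.toReal_ofReal (abs_nonneg _), abs_of_nonneg (by positivity), Measure.real]

/-- **Brunn–Minkowski inequality** for convex bodies of volumes `k ^ d` and `l ^ d`, together with
the case of equality. -/
theorem brunnMinkowski (μ : Measure F) [μ.IsAddHaarMeasure] {K L : Set F}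
    (hKc : IsCompact K) (hK : Convex ℝ K) (hKi : (interior K).Nonempty)
    (hLc : IsCompact L) (hL : Convex ℝ L) (hLi : (interior L).Nonempty)
    {k l : ℝ} (hk : 0 < k) (hl : 0 < l) (hKk : μ.real K = k ^ Module.finrank ℝ F)
    (hLl : μ.real L = l ^ Module.finrank ℝ F) :
    (k + l) ^ Module.finrank ℝ F ≤ μ.real (K + L) ∧
    (μ.real (K + L) ≤ (k + l) ^ Module.finrank ℝ F →
      ∃ t : F, ∀ u : F →L[ℝ] ℝ, suppFn K u / k = suppFn L u / l + u t) := by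
  set d := Module.finrank ℝ F with hd
  -- With this weight, `(1 - w) • (k⁻¹ • K) + w • (l⁻¹ • L)` is `(k + l)⁻¹ • (K + L)`. The
  -- multiplicative inequality for bodies of volume one thus becomes the additive one.
  set w := l / (k + l) with hw
  have hkl : 0 < k + l := by positivity
  have hw0 : 0 < w := by positivity
  have hw1 : w < 1 := by rw [hw, div_lt_one hkl]; linarith
  have hw' : 1 - w = k / (k + l) := by rw [hw]; field_simp; ring
  have hKv : μ.real (k⁻¹ • K) = 1 := by
    rw [measureReal_smul μ (by positivity), hKk, ← hd, ← mul_pow, inv_mul_cancel₀ hk.ne', one_pow]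
  have hLv : μ.real (l⁻¹ • L) = 1 := by
    rw [measureReal_smul μ (by positivity), hLl, ← hd, ← mul_pow, inv_mul_cancel₀ hl.ne', one_pow]
  have hsum : (1 - w) • (k⁻¹ • K) + w • (l⁻¹ • L) = (k + l)⁻¹ • (K + L) := by
    rw [smul_smul, smul_smul, smul_add, hw', hw]
    congr 2
    · field_simp
    · field_simp
  have hsumv : μ.real ((1 - w) • (k⁻¹ • K) + w • (l⁻¹ • L)) =
      ((k + l) ^ d)⁻¹ * μ.real (K + L) := by
    rw [hsum, measureReal_smul μ (by positivity), inv_pow]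
  have hp : 0 < (k + l) ^ d := by positivity
  have hint : ∀ {c : ℝ} {M : Set F}, 0 < c → (interior M).Nonempty →
      (interior (c • M)).Nonempty := fun hc h => by
    rw [interior_smul₀ hc.ne']; exact h.smul_set
  have hne : ∀ {M : Set F}, (interior M).Nonempty → M.Nonempty := fun h => h.mono interior_subset
  constructor
  · have h1 := logBrunnMinkowski μ (hKc.smul k⁻¹) (hK.smul k⁻¹) (hne hKi).smul_set
      (hLc.smul l⁻¹) (hL.smul l⁻¹) (hne hLi).smul_set hw0 hw1
    rw [hKv, hLv, hsumv, Real.one_rpow, Real.one_rpow, one_mul] at h1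
    rw [inv_mul_eq_div, le_div_iff₀ hp, one_mul] at h1
    exact h1
  · intro hup
    obtain ⟨t, ht⟩ := exists_suppFn_eq_add_of_measureReal_le μ (hKc.smul k⁻¹) (hK.smul k⁻¹)
      (hint (by positivity) hKi) (hLc.smul l⁻¹) (hL.smul l⁻¹) (hint (by positivity) hLi) hw0 hw1
      (by
        rw [hKv, hLv, hsumv, Real.one_rpow, Real.one_rpow, one_mul, inv_mul_eq_div,
          div_le_one hp]
        exact hup)
    refine ⟨t, fun u => ?_⟩
    have := ht u
    rw [suppFn_smul (by positivity), suppFn_smul (by positivity)] at this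
    rw [div_eq_inv_mul, div_eq_inv_mul, this]

end BrunnMinkowski

/-! ### The volume of `s K + L` is a polynomial in `s` -/

section LogLaplace

open scoped RealInnerProductSpace

variable {F : Type*} [NormedAddCommGroup F] [InnerProductSpace ℝ F]

lemma continuous_innerSL_smulRight {X V : Type*} [TopologicalSpace X] [NormedAddCommGroup V]
    [NormedSpace ℝ V] {c : X → F} {g : X → V} (hc : Continuous c) (hg : Continuous g) :
    Continuous fun y => (innerSL ℝ (c y)).smulRight (g y) :=
  (ContinuousLinearMap.smulRightL ℝ F V).continuous₂.comp
    (((innerSL ℝ).continuous.comp hc).prodMk hg)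

variable [FiniteDimensional ℝ F] [MeasurableSpace F] [BorelSpace F]

lemma integrableOn_exp_inner_smul {V : Type*} [NormedAddCommGroup V] [NormedSpace ℝ V]
    {K : Set F} (hK : IsCompact K) {g : F → V} (x : F) (hg : Continuous g) :
    IntegrableOn (fun y => Real.exp ⟪x, y⟫ • g y) K :=
  ContinuousOn.integrableOn_compact hK (by fun_prop)

lemma hasFDerivAt_integral_exp_inner_smul {V : Type*} [NormedAddCommGroup V] [NormedSpace ℝ V]
    [CompleteSpace V] {K : Set F} (hK : IsCompact K) {g : F → V} (hg : Continuous g) (x : F) :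
    HasFDerivAt (fun x => ∫ y in K, Real.exp ⟪x, y⟫ • g y)
      (∫ y in K, Real.exp ⟪x, y⟫ • (innerSL ℝ y).smulRight (g y)) x := by
  have hc : Continuous fun p : F × F =>
      Real.exp ⟪p.1, p.2⟫ • (innerSL ℝ p.2).smulRight (g p.2) := by
    have h1 : Continuous fun p : F × F => Real.exp ⟪p.1, p.2⟫ := by fun_prop
    exact h1.smul (continuous_innerSL_smulRight continuous_snd (hg.comp continuous_snd))
  obtain ⟨C, hC⟩ := ((isCompact_closedBall x 1).prod hK).exists_bound_of_continuousOn
    hc.continuousOn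
  refine hasFDerivAt_integral_of_dominated_of_fderiv_le (bound := fun _ => C)
    (F' := fun x y => Real.exp ⟪x, y⟫ • (innerSL ℝ y).smulRight (g y))
    (Metric.closedBall_mem_nhds x one_pos) ?_ ?_ ?_ ?_ ?_ ?_
  · refine Eventually.of_forall fun z => Continuous.aestronglyMeasurable ?_
    fun_prop
  · exact integrableOn_exp_inner_smul hK x hg
  · exact (hc.comp (by fun_prop : Continuous fun y => (x, y))).aestronglyMeasurable
  · refine ae_restrict_of_forall_mem hK.measurableSet fun y hy z hz => ?_
    exact hC (z, y) ⟨hz, hy⟩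
  · exact integrableOn_const hK.measure_ne_top
  · refine Eventually.of_forall fun y z _ => ?_
    have h1 : HasFDerivAt (fun z : F => ⟪z, y⟫) (innerSL ℝ y) z := by
      have := (innerSL ℝ y).hasFDerivAt (x := z)
      refine this.congr_of_eventuallyEq (Eventually.of_forall fun z => ?_)
      simp [real_inner_comm]
    have h2 := h1.exp.smul_const (g y)
    convert h2 using 1
    ext v
    simp [smul_smul]

/-- The gradient of the logarithmic Laplace transform of a convex body is a smooth strictly monotone
map into the body. -/
lemma exists_monotone_map {K : Set F} (hKc : IsCompact K) (hK : Convex ℝ K)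
    (hKi : (interior K).Nonempty) :
    ∃ (T : F → F) (H : F → F →L[ℝ] F) (ψ : F → ℝ),
      (∀ x, HasFDerivAt T (H x) x) ∧ (∀ x, HasFDerivAt ψ (innerSL ℝ (T x)) x) ∧
      (∀ x v w, ⟪H x v, w⟫ = ⟪v, H x w⟫) ∧ (∀ x v, v ≠ 0 → 0 < ⟪H x v, v⟫) ∧
      (∀ x, T x ∈ K) ∧
      ∀ a ∈ interior K, ∃ c, ∃ r > 0, ∀ x, c + r * ‖x‖ ≤ ψ x - ⟪x, a⟫ := by
  -- `Z` is the Laplace transform of `K`. Under the density `exp ⟪x, y⟫ / Z x` on `K`, the vector `T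
  -- x` is the mean, hence in `K`, and `H x` is the covariance, positive definite because `K` has
  -- interior points. They are the gradient and Hessian of `log Z`.
  set Z : F → ℝ := fun x => ∫ y in K, Real.exp ⟪x, y⟫ with hZ
  set T : F → F := fun x => (Z x)⁻¹ • ∫ y in K, Real.exp ⟪x, y⟫ • y with hT
  set H : F → F →L[ℝ] F := fun x => (Z x)⁻¹ •
    ∫ y in K, Real.exp ⟪x, y⟫ • (innerSL ℝ (y - T x)).smulRight (y - T x) with hH
  have hid : ∀ x, IntegrableOn (fun y => Real.exp ⟪x, y⟫ • y) K := fun x =>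
    integrableOn_exp_inner_smul hKc x continuous_id
  have hZint : ∀ x, IntegrableOn (fun y => Real.exp ⟪x, y⟫) K := fun x => by
    simpa using integrableOn_exp_inner_smul hKc (g := fun _ => (1 : ℝ)) x continuous_const
  have hpos : ∀ (f : F → ℝ), Continuous f → (∀ y, 0 ≤ f y) → (∃ y ∈ interior K, f y ≠ 0) →
      0 < ∫ y in K, f y := by
    rintro f hf hf0 ⟨y, hy, hyf⟩
    rw [setIntegral_pos_iff_support_of_nonneg_ae (Eventually.of_forall hf0)
      (hf.continuousOn.integrableOn_compact hKc)]
    have ho : IsOpen (Function.support f ∩ interior K) := hf.isOpen_support.inter isOpen_interior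
    exact (ho.measure_pos volume ⟨y, hyf, hy⟩).trans_le
      (measure_mono (inter_subset_inter_right _ interior_subset))
  have hZpos : ∀ x, 0 < Z x := fun x => hpos _ (by fun_prop) (fun y => (Real.exp_pos _).le)
    (hKi.imp fun y hy => ⟨hy, (Real.exp_pos _).ne'⟩)
  have hcen : ∀ x, ∫ y in K, Real.exp ⟪x, y⟫ • (y - T x) = 0 := by
    intro x
    simp only [smul_sub]
    rw [integral_sub (hid x) (integrableOn_exp_inner_smul hKc x continuous_const), integral_smul_const]
    simp only [hT]
    rw [smul_smul, mul_inv_cancel₀ (hZpos x).ne', one_smul, sub_self]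
  have hZd : ∀ x, HasFDerivAt Z (innerSL ℝ (Z x • T x)) x := by
    intro x
    have h := hasFDerivAt_integral_exp_inner_smul hKc (g := fun _ => (1 : ℝ)) continuous_const x
    simp only [smul_eq_mul, mul_one] at h
    refine h.congr_fderiv ?_
    ext v
    rw [ContinuousLinearMap.integral_apply (integrableOn_exp_inner_smul hKc x
      (continuous_innerSL_smulRight (c := fun y => y) continuous_id continuous_const))]
    simp only [hT, smul_smul, mul_inv_cancel₀ (hZpos x).ne', one_smul]
    rw [innerSL_apply_apply, real_inner_comm, ← innerSL_apply_apply ℝ,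
      ← ContinuousLinearMap.integral_comp_comm _ (hid x)]
    simp [real_inner_comm]
  have hHapp : ∀ x v, H x v = (Z x)⁻¹ • ∫ y in K, Real.exp ⟪x, y⟫ • (⟪y - T x, v⟫ • (y - T x)) := by
    intro x v
    simp only [hH, smul_apply]
    rw [ContinuousLinearMap.integral_apply]
    · simp only [smul_apply, ContinuousLinearMap.smulRight_apply, innerSL_apply_apply]
    · refine integrableOn_exp_inner_smul hKc x ?_
      exact continuous_innerSL_smulRight (by fun_prop) (by fun_prop)
  have hHinner : ∀ x v w, ⟪H x v, w⟫ =
      (Z x)⁻¹ * ∫ y in K, Real.exp ⟪x, y⟫ * (⟪y - T x, v⟫ * ⟪y - T x, w⟫) := by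
    intro x v w
    rw [hHapp, real_inner_smul_left, real_inner_comm, ← innerSL_apply_apply ℝ,
      ← ContinuousLinearMap.integral_comp_comm _ (integrableOn_exp_inner_smul hKc x (by fun_prop))]
    simp only [map_smul, innerSL_apply_apply, smul_eq_mul, real_inner_comm w]
  refine ⟨T, H, fun x => Real.log (Z x), ?_, ?_, ?_, ?_, ?_, ?_⟩
  · intro x
    -- Recentring at the fixed vector `T x` makes the integral vanish at `x`, so the product-rule
    -- term containing the derivative of `Z⁻¹` drops out.
    have hN := hasFDerivAt_integral_exp_inner_smul hKc (g := fun y => y - T x) (by fun_prop) x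
    have hZi := (hasDerivAt_inv (hZpos x).ne').comp_hasFDerivAt x (hZd x)
    have h1 := hZi.smul hN
    have h2 : T = fun x' => (Z x')⁻¹ • (∫ y in K, Real.exp ⟪x', y⟫ • (y - T x)) + T x := by
      funext x'
      simp only [smul_sub]
      rw [integral_sub (hid x') (integrableOn_exp_inner_smul hKc x' continuous_const), integral_smul_const,
        smul_sub, smul_smul, inv_mul_cancel₀ (hZpos x').ne', one_smul]
      simp [hT]
    have h3 := h1.add_const (T x)
    refine (h3.congr_of_eventuallyEq
      (Eventually.of_forall fun x' => congrFun h2 x')).congr_fderiv ?_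
    ext1 v
    symm
    rw [hHapp]
    simp only [hcen, ContinuousLinearMap.smulRight_zero, add_zero, smul_apply, Function.comp]
    congr 1
    rw [ContinuousLinearMap.integral_apply]
    · simp only [smul_apply, ContinuousLinearMap.smulRight_apply,
        innerSL_apply_apply]
      have h4 : ∀ y : F, Real.exp ⟪x, y⟫ • (⟪y - T x, v⟫ • (y - T x)) =
          Real.exp ⟪x, y⟫ • (⟪y, v⟫ • (y - T x)) -
            ⟪T x, v⟫ • (Real.exp ⟪x, y⟫ • (y - T x)) := by
        intro y
        rw [inner_sub_left, sub_smul, smul_sub, smul_comm ⟪T x, v⟫]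
      simp only [h4]
      have i1 : IntegrableOn (fun y => Real.exp ⟪x, y⟫ • (⟪y, v⟫ • (y - T x))) K :=
        integrableOn_exp_inner_smul hKc x (by fun_prop)
      have i2 : IntegrableOn (fun y => ⟪T x, v⟫ • (Real.exp ⟪x, y⟫ • (y - T x))) K :=
        (integrableOn_exp_inner_smul hKc x (by fun_prop)).smul _
      rw [integral_sub i1 i2, integral_smul, hcen, smul_zero, sub_zero]
    · refine integrableOn_exp_inner_smul hKc x ?_
      exact continuous_innerSL_smulRight (by fun_prop) (by fun_prop)
  · intro x
    convert (hZd x).log (hZpos x).ne' using 1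
    rw [map_smul (innerSL ℝ) (Z x) (T x), smul_smul, inv_mul_cancel₀ (hZpos x).ne', one_smul]
  · intro x v w
    rw [hHinner, real_inner_comm, hHinner]
    simp only [mul_comm ⟪_ - T x, v⟫]
  · intro x v hv
    rw [hHinner]
    refine mul_pos (inv_pos.2 (hZpos x)) (hpos _ (by fun_prop)
      (fun y => mul_nonneg (Real.exp_pos _).le (mul_self_nonneg _)) ?_)
    obtain ⟨y, hy⟩ := hKi
    by_contra! hcon
    have hz : ∀ z ∈ interior K, ⟪z - T x, v⟫ = 0 := by
      intro z hz
      have := hcon z hz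
      have h3 := (Real.exp_pos ⟪x, z⟫).ne'
      simpa [h3] using this
    have hcv : ContinuousAt (fun t : ℝ => y + t • v) 0 := by fun_prop
    have hev : ∀ᶠ t in 𝓝 (0 : ℝ), y + t • v ∈ interior K :=
      hcv (by simpa using isOpen_interior.mem_nhds hy)
    obtain ⟨t, ht, ht0⟩ := ((hev.filter_mono nhdsWithin_le_nhds).and
      (self_mem_nhdsWithin : Ioi (0 : ℝ) ∈ 𝓝[>] 0)).exists
    have h1 := hz _ ht
    have h2 := hz _ hy
    rw [add_sub_right_comm, inner_add_left, h2, zero_add, real_inner_smul_left] at h1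
    have : ⟪v, v⟫ ≠ 0 := inner_self_ne_zero.2 hv
    exact (mul_ne_zero (ne_of_gt ht0) this) h1
  · intro x
    by_contra hx
    obtain ⟨f, r, h1, h2⟩ := geometric_hahn_banach_closed_point hK hKc.isClosed hx
    have h3 : f (T x) = (Z x)⁻¹ * ∫ y in K, Real.exp ⟪x, y⟫ * f y := by
      simp only [hT, map_smul, smul_eq_mul]
      rw [← ContinuousLinearMap.integral_comp_comm _ (hid x)]
      simp
    have h4 : ∫ y in K, Real.exp ⟪x, y⟫ * f y ≤ ∫ y in K, Real.exp ⟪x, y⟫ * r := by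
      refine setIntegral_mono_on (integrableOn_exp_inner_smul hKc x f.continuous) ((hZint x).mul_const r) hKc.measurableSet ?_
      intro y hy
      gcongr
      exact (h1 y hy).le
    rw [integral_mul_const] at h4
    have h5 : f (T x) ≤ r := by
      rw [h3, inv_mul_le_iff₀ (hZpos x)]
      exact h4
    linarith
  · intro a ha
    obtain ⟨r, hr, hball⟩ := Metric.isOpen_iff.1 isOpen_interior a ha
    -- The ball of radius `ρ` about `a + 2ρ x / ‖x‖` stays in the ball of radius `r` about `a`, and
    -- on it `⟪x, y⟫ ≥ ⟪x, a⟫ + 2ρ‖x‖ - ρ‖x‖`. This gives linear growth with slope `ρ`.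
    set ρ := r / 4 with hρ
    have hρ0 : 0 < ρ := by positivity
    set κ := volume.real (Metric.ball (0 : F) ρ) with hκ
    have hκ0 : 0 < κ := ENNReal.toReal_pos (Metric.measure_ball_pos _ _ hρ0).ne'
      measure_ball_lt_top.ne
    refine ⟨Real.log κ, ρ, hρ0, fun x => ?_⟩
    set p := a + (2 * ρ) • (‖x‖⁻¹ • x) with hp
    have hnx : ‖‖x‖⁻¹ • x‖ ≤ 1 := by
      rw [norm_smul, norm_inv, norm_norm]
      exact inv_mul_le_one
    have hsub : Metric.ball p ρ ⊆ K := by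
      refine Subset.trans ?_ (hball.trans interior_subset)
      refine Metric.ball_subset_ball' ?_
      rw [hp, dist_self_add_left, norm_smul, Real.norm_of_nonneg (by positivity)]
      nlinarith
    have hlow : ∀ y ∈ Metric.ball p ρ, Real.exp (⟪x, a⟫ + ρ * ‖x‖) ≤ Real.exp ⟪x, y⟫ := by
      intro y hy
      apply Real.exp_le_exp.2
      have e1 : ⟪x, y⟫ = ⟪x, a⟫ + 2 * ρ * ‖x‖ + ⟪x, y - p⟫ := by
        rw [inner_sub_right, hp, inner_add_right, inner_smul_right, inner_smul_right,
          real_inner_self_eq_norm_sq]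
        by_cases hx0 : ‖x‖ = 0
        · simp [hx0]
        · field_simp; ring
      have e2 : |⟪x, y - p⟫| ≤ ‖x‖ * ‖y - p‖ := abs_real_inner_le_norm _ _
      have e3 : ‖y - p‖ < ρ := by rwa [← dist_eq_norm]
      have e4 := neg_abs_le ⟪x, y - p⟫
      nlinarith [norm_nonneg x]
    have hZlow : κ * Real.exp (⟪x, a⟫ + ρ * ‖x‖) ≤ Z x := by
      calc κ * Real.exp (⟪x, a⟫ + ρ * ‖x‖)
          = ∫ _ in Metric.ball p ρ, Real.exp (⟪x, a⟫ + ρ * ‖x‖) := by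
            rw [setIntegral_const, smul_eq_mul, hκ, Measure.real, Measure.real,
              Measure.addHaar_ball_center volume p]
        _ ≤ ∫ y in Metric.ball p ρ, Real.exp ⟪x, y⟫ :=
            setIntegral_mono_on (integrableOn_const measure_ball_lt_top.ne)
              ((hZint x).mono_set hsub) measurableSet_ball hlow
        _ ≤ Z x := setIntegral_mono_set (hZint x)
            (Eventually.of_forall fun y => (Real.exp_pos _).le) hsub.eventuallyLE
    have := Real.log_le_log (by positivity) hZlow
    rw [Real.log_mul hκ0.ne' (Real.exp_pos _).ne', Real.log_exp] at this
    linarith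

end LogLaplace

/-! ### The volume as the integral of a Jacobian determinant -/

section VolumePolynomial

open scoped RealInnerProductSpace
open Polynomial

variable {F : Type*} [NormedAddCommGroup F] [InnerProductSpace ℝ F] [FiniteDimensional ℝ F]

lemma det_nonneg_of_symmetric (A : F →L[ℝ] F) (hs : ∀ v w, ⟪A v, w⟫ = ⟪v, A w⟫)
    (hp : ∀ v, 0 ≤ ⟪A v, v⟫) : 0 ≤ A.det := by
  have h : (A : F →ₗ[ℝ] F).IsPositive := ⟨hs, hp⟩
  have := ((LinearMap.posSemidef_toMatrix_iff (stdOrthonormalBasis ℝ F)).2 h).det_nonneg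
  rwa [LinearMap.det_toMatrix] at this

lemma exists_polynomial_eval_eq_det (A B : F →L[ℝ] F) :
    ∃ p : ℝ[X], p.natDegree ≤ Module.finrank ℝ F ∧ ∀ s : ℝ, p.eval s = (s • A + B).det := by
  let b := (stdOrthonormalBasis ℝ F).toBasis
  let a' := LinearMap.toMatrix b b (A : F →ₗ[ℝ] F)
  let b' := LinearMap.toMatrix b b (B : F →ₗ[ℝ] F)
  refine ⟨((X : ℝ[X]) • a'.map C + b'.map C).det, ?_, fun s => ?_⟩
  · simpa using natDegree_det_X_add_C_le a' b'
  · have h : (s • A + B).det = (s • a' + b').det := by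
      rw [ContinuousLinearMap.det, ← LinearMap.det_toMatrix b]
      simp [a', b']
    rw [h, ← coe_evalRingHom, RingHom.map_det]
    congr 1
    ext i j
    simp
    ring

variable [MeasurableSpace F] [BorelSpace F]

/-- The volume of `s K + L` is the integral of a determinant depending affinely on `s`. -/
lemma exists_volume_eq_lintegral_det {K L : Set F}
    (hKc : IsCompact K) (hK : Convex ℝ K) (hKi : (interior K).Nonempty)
    (hLc : IsCompact L) (hL : Convex ℝ L) (hLi : (interior L).Nonempty) :
    ∃ A B : F → F →L[ℝ] F, Measurable A ∧ Measurable B ∧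
      ∀ s : ℝ, 0 ≤ s → (∀ x, 0 ≤ (s • A x + B x).det) ∧
        ∫⁻ x, ENNReal.ofReal (s • A x + B x).det = volume (s • K + L) := by
  obtain ⟨T, A, ψ, hT, hψ, hAs, hAp, hTK, hc⟩ := exists_monotone_map hKc hK hKi
  obtain ⟨T', B, ψ', hT', hψ', hBs, hBp, hTL, hc'⟩ := exists_monotone_map hLc hL hLi
  have hmeas : ∀ {T : F → F} {A : F → F →L[ℝ] F}, (∀ x, HasFDerivAt T (A x) x) → Measurable A := by
    intro T A h
    have : A = fderiv ℝ T := funext fun x => (h x).fderiv.symm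
    rw [this]
    exact measurable_fderiv ℝ T
  refine ⟨A, B, hmeas hT, hmeas hT', fun s hs => ?_⟩
  have hpos : ∀ x v, v ≠ 0 → 0 < ⟪(s • A x + B x) v, v⟫ := by
    intro x v hv
    have h1 := mul_nonneg hs (hAp x v hv).le
    have h2 := hBp x v hv
    simp only [add_apply, smul_apply, inner_add_left,
      real_inner_smul_left]
    linarith
  have hdet : ∀ x, 0 ≤ (s • A x + B x).det := by
    intro x
    apply det_nonneg_of_symmetric
    · intro v w
      simp only [add_apply, smul_apply, inner_add_left, inner_add_right, real_inner_smul_left,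
        real_inner_smul_right, hAs, hBs]
    · intro v
      by_cases hv : v = 0
      · simp [hv]
      · exact (hpos x v hv).le
  refine ⟨hdet, ?_⟩
  -- `S` is the gradient of `s ψ + ψ'`. It is injective by strict monotonicity, and its range lies
  -- between `s • interior K + interior L` and `s • K + L`. These have equal volume because the
  -- frontier of a convex set is null.
  set S : F → F := fun x => s • T x + T' x with hS
  have hSd : ∀ x, HasFDerivAt S (s • A x + B x) x := fun x => ((hT x).const_smul s).add (hT' x)
  have hinj : Function.Injective S := by
    intro x x' hxx
    by_contra hne
    set v := x' - x with hv
    have hv0 : v ≠ 0 := sub_ne_zero.2 (Ne.symm hne)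
    have hd : ∀ r : ℝ, HasDerivAt (fun r : ℝ => ⟪S (x + r • v), v⟫)
        ⟪(s • A (x + r • v) + B (x + r • v)) v, v⟫ r := by
      intro r
      have h1 : HasDerivAt (fun r : ℝ => x + r • v) v r := by
        simpa using ((hasDerivAt_id r).smul_const v).const_add x
      have h2 := (hSd (x + r • v)).comp_hasDerivAt r h1
      simpa using h2.inner ℝ (hasDerivAt_const r v)
    have hmono : StrictMono fun r : ℝ => ⟪S (x + r • v), v⟫ :=
      strictMono_of_deriv_pos fun r => by rw [(hd r).deriv]; exact hpos _ _ hv0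
    have h01 := hmono (zero_lt_one' ℝ)
    simp only [zero_smul, add_zero, one_smul, hv, add_sub_cancel, hxx] at h01
    exact lt_irrefl _ h01
  have himg : ∫⁻ x, ENNReal.ofReal (s • A x + B x).det = volume (range S) := by
    rw [← image_univ, ← lintegral_abs_det_fderiv_eq_addHaar_image volume MeasurableSet.univ
      (fun x _ => (hSd x).hasFDerivWithinAt) hinj.injOn, setLIntegral_univ]
    simp only [abs_of_nonneg (hdet _)]
  set U : Set F := s • interior K + interior L with hU
  have hUo : IsOpen U := isOpen_interior.add_left
  have hUc : Convex ℝ U := (hK.interior.smul s).add hL.interior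
  have hUS : U ⊆ range S := by
    rintro _ ⟨_, ⟨a, ha, rfl⟩, b, hb, rfl⟩
    obtain ⟨c, r, hr, hcr⟩ := hc a ha
    obtain ⟨c', r', hr', hcr'⟩ := hc' b hb
    -- The target `s • a + b` is attained at a minimizer of `s ψ + ψ'` minus the corresponding
    -- linear form. The minimizer exists because `ψ' - ⟪·, b⟫` grows linearly while the other term
    -- is bounded below.
    set Φ : F → ℝ := fun x => s * (ψ x - ⟪x, a⟫) + (ψ' x - ⟪x, b⟫) with hΦ
    have hin : ∀ a x : F, HasFDerivAt (fun x : F => ⟪x, a⟫) (innerSL ℝ a) x := by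
      intro a x
      refine (innerSL ℝ a).hasFDerivAt.congr_of_eventuallyEq (Eventually.of_forall fun z => ?_)
      simp [real_inner_comm]
    have hΦd : ∀ x, HasFDerivAt Φ (s • (innerSL ℝ (T x) - innerSL ℝ a) +
        (innerSL ℝ (T' x) - innerSL ℝ b)) x := fun x =>
      (((hψ x).sub (hin a x)).const_mul s).add ((hψ' x).sub (hin b x))
    have hΦc : Continuous Φ := continuous_iff_continuousAt.2 fun x => (hΦd x).continuousAt
    have hlim : Tendsto Φ (cocompact F) atTop := by
      have h1 : Tendsto (fun x : F => (s * c + c') + r' * ‖x‖) (cocompact F) atTop :=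
        tendsto_atTop_add_const_left _ _ (tendsto_norm_cocompact_atTop.const_mul_atTop hr')
      refine tendsto_atTop_mono (fun x => ?_) h1
      have e1 := mul_le_mul_of_nonneg_left (hcr x) hs
      have e2 := hcr' x
      have e3 : 0 ≤ s * (r * ‖x‖) := by positivity
      simp only [hΦ]
      linarith
    obtain ⟨x, hx⟩ := hΦc.exists_forall_le hlim
    have h0 := (isMinOn_univ_iff.2 hx |>.isLocalMin univ_mem).hasFDerivAt_eq_zero (hΦd x)
    refine ⟨x, ?_⟩
    have h1 : ∀ v, ⟪S x - (s • a + b), v⟫ = 0 := by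
      intro v
      have := congrArg (fun f : F →L[ℝ] ℝ => f v) h0
      simp only [add_apply, smul_apply, sub_apply, innerSL_apply_apply, zero_apply,
        smul_eq_mul] at this
      simp only [hS, inner_sub_left, inner_add_left, real_inner_smul_left]
      linarith
    exact sub_eq_zero.1 (inner_self_eq_zero.1 (h1 _))
  have hSsub : range S ⊆ s • K + L := by
    rintro _ ⟨x, rfl⟩
    exact ⟨_, ⟨_, hTK x, rfl⟩, _, hTL x, rfl⟩
  have hcl : s • K + L ⊆ closure U := by
    have hK' : K ⊆ closure (interior K) := by
      rw [hK.closure_interior_eq_closure_of_nonempty_interior hKi]; exact subset_closure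
    have hL' : L ⊆ closure (interior L) := by
      rw [hL.closure_interior_eq_closure_of_nonempty_interior hLi]; exact subset_closure
    rintro _ ⟨_, ⟨a, ha, rfl⟩, b, hb, rfl⟩
    exact map_mem_closure₂ (f := fun a b => s • a + b) (by fun_prop) (hK' ha) (hL' hb)
      fun a ha b hb => ⟨_, ⟨_, ha, rfl⟩, _, hb, rfl⟩
  rw [himg]
  refine le_antisymm (measure_mono hSsub) ((measure_mono hcl).trans ?_)
  rw [closure_eq_self_union_frontier]
  refine (measure_union_le _ _).trans ?_
  rw [hUc.addHaar_frontier volume, add_zero]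
  exact measure_mono hUS

/-- The volume of `s K + L` is a polynomial in `s ≥ 0`. -/
theorem exists_polynomial_volume_smul_add {K L : Set F}
    (hKc : IsCompact K) (hK : Convex ℝ K) (hKi : (interior K).Nonempty)
    (hLc : IsCompact L) (hL : Convex ℝ L) (hLi : (interior L).Nonempty) :
    ∃ P : ℝ[X], P.natDegree ≤ Module.finrank ℝ F ∧
      ∀ s : ℝ, 0 ≤ s → volume.real (s • K + L) = P.eval s := by
  obtain ⟨A, B, hA, hB, h⟩ := exists_volume_eq_lintegral_det hKc hK hKi hLc hL hLi
  set d := Module.finrank ℝ F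
  choose p hp1 hp2 using fun x => exists_polynomial_eval_eq_det (A x) (B x)
  have hm : ∀ s : ℝ, Measurable fun x => (s • A x + B x).det := fun s =>
    ContinuousLinearMap.continuous_det.measurable.comp ((hA.const_smul s).add hB)
  have hfin : ∀ s : ℝ, volume (s • K + L) ≠ ⊤ := fun s => ((hKc.smul s).add hLc).measure_ne_top
  have hint : ∀ s : ℝ, 0 ≤ s → Integrable fun x => (s • A x + B x).det := by
    intro s hs
    refine ⟨(hm s).aestronglyMeasurable, ?_⟩
    rw [hasFiniteIntegral_iff_ofReal (Eventually.of_forall (h s hs).1), (h s hs).2]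
    exact (hfin s).lt_top
  have hval : ∀ s : ℝ, 0 ≤ s → volume.real (s • K + L) = ∫ x, (s • A x + B x).det := by
    intro s hs
    rw [integral_eq_lintegral_of_nonneg_ae (Eventually.of_forall (h s hs).1)
      (hm s).aestronglyMeasurable, (h s hs).2, Measure.real]
  have hvs : Set.InjOn (fun i : ℕ => (i : ℝ)) (Finset.range (d + 1)) :=
    Nat.cast_injective.injOn
  -- Interpolation at `0, …, d` writes each determinant as a combination of its values there, with
  -- weights independent of `x`. Integrating this never requires integrability of the coefficients.
  refine ⟨Lagrange.interpolate (Finset.range (d + 1)) (fun i : ℕ => (i : ℝ))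
    fun i => volume.real ((i : ℝ) • K + L), ?_, ?_⟩
  · have := Lagrange.degree_interpolate_lt
      (fun i : ℕ => volume.real ((i : ℝ) • K + L)) hvs
    rw [Finset.card_range] at this
    exact natDegree_le_iff_coeff_eq_zero.2 fun i hi => (degree_lt_iff_coeff_zero _ _).1 this i hi
  · intro s hs
    have hlag : ∀ x, (s • A x + B x).det = ∑ i ∈ Finset.range (d + 1),
        ((i : ℝ) • A x + B x).det *
          (Lagrange.basis (Finset.range (d + 1)) (fun i : ℕ => (i : ℝ)) i).eval s := by
      intro x
      have h1 : (p x).degree < (Finset.range (d + 1)).card := by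
        rw [Finset.card_range]
        exact (degree_le_natDegree.trans (WithBot.coe_le_coe.2 (hp1 x))).trans_lt
          (WithBot.coe_lt_coe.2 (Nat.lt_succ_self d))
      have h2 := congrArg (eval s) (Lagrange.eq_interpolate hvs h1)
      rw [hp2, Lagrange.interpolate_apply, eval_finsetSum] at h2
      simpa only [eval_mul, eval_C, hp2] using h2
    rw [hval s hs]
    simp only [hlag]
    rw [integral_finsetSum _ fun (i : ℕ) _ => (hint (i : ℝ) i.cast_nonneg).mul_const _,
      Lagrange.interpolate_apply, eval_finsetSum]
    refine Finset.sum_congr rfl fun i _ => ?_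
    rw [integral_mul_const, eval_mul, eval_C, hval i (Nat.cast_nonneg i)]

end VolumePolynomial

/-! ### The mixed volume `V(K, …, K, L)` and Minkowski's first inequality -/

/-- Subsets are split by whether they contain the last index, the slot of `L`. In each half the
Minkowski sums depend only on the number of copies of `K`. -/
lemma sum_powerset_fin_succ {M : Type*} [AddCommMonoid M] (m : ℕ) (f : Finset (Fin (m + 1)) → M)
    (a b : ℕ → M)
    (ha : ∀ S, Fin.last m ∉ S → f S = a S.card)
    (hb : ∀ S, Fin.last m ∉ S → f (insert (Fin.last m) S) = b S.card) :
    ∑ S, f S = ∑ k ∈ Finset.range (m + 1), m.choose k • (a k + b k) := by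
  set s : Finset (Fin (m + 1)) := Finset.univ.map Fin.castSuccEmb with hs
  have hlast : Fin.last m ∉ s := by simp [hs]
  have huniv : (Finset.univ : Finset (Finset (Fin (m + 1)))) = (insert (Fin.last m) s).powerset := by
    rw [← Finset.powerset_univ, Fin.univ_castSuccEmb, Finset.cons_eq_insert]
  have hcard : s.card = m := by simp [hs]
  have hnot : ∀ t ∈ s.powerset, Fin.last m ∉ t := fun t ht h =>
    hlast (Finset.mem_powerset.1 ht h)
  rw [huniv, Finset.sum_powerset_insert hlast,
    Finset.sum_congr rfl fun t ht => ha t (hnot t ht),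
    Finset.sum_congr rfl fun t ht => hb t (hnot t ht), Finset.sum_powerset_apply_card,
    Finset.sum_powerset_apply_card, hcard, ← Finset.sum_add_distrib]
  simp only [smul_add]

section MixedVolume

open Polynomial

variable {F : Type*} [NormedAddCommGroup F] [InnerProductSpace ℝ F] [FiniteDimensional ℝ F]
  [MeasurableSpace F] [BorelSpace F]

/-- The mixed volume of `j - 1` copies of `K` and one copy of `L`. -/
def mixedVolumePair (j : ℕ) (K L : ConvexBody F) : ℝ :=
  mixedVolume fun i : Fin j => if (i : ℕ) + 1 = j then L else K

lemma coe_nsmul_convexBody {V : Type*} [NormedAddCommGroup V] [NormedSpace ℝ V] (k : ℕ)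
    (K : ConvexBody V) : ((k • K : ConvexBody V) : Set V) = (k : ℝ) • (K : Set V) := by
  induction k with
  | zero => simp [Set.zero_smul_set K.nonempty]
  | succ k ih =>
    rw [succ_nsmul, ConvexBody.coe_add, ih, Nat.cast_succ,
      K.convex.add_smul (Nat.cast_nonneg k) zero_le_one, one_smul]

lemma mixedVolumePair_eq_sum (m : ℕ) (K L : ConvexBody F) :
    mixedVolumePair (m + 1) K L = ((m + 1).factorial : ℝ)⁻¹ * ∑ k ∈ Finset.range (m + 1),
      (-1 : ℝ) ^ (m - k) * m.choose k *
        (volume.real ((k : ℝ) • (K : Set F) + (L : Set F)) - volume.real ((k : ℝ) • (K : Set F))) := by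
  rw [mixedVolumePair, mixedVolume]
  congr 1
  have hsum : ∀ S : Finset (Fin (m + 1)), Fin.last m ∉ S →
      (∑ i ∈ S, if (i : ℕ) + 1 = m + 1 then L else K) = S.card • K := by
    intro S hS
    rw [← Finset.sum_const]
    refine Finset.sum_congr rfl fun i hi => if_neg fun h => hS ?_
    have : i = Fin.last m := Fin.ext (by simpa using h)
    exact this ▸ hi
  have hle : ∀ S : Finset (Fin (m + 1)), Fin.last m ∉ S → S.card ≤ m := by
    intro S hS
    have := Finset.card_le_univ (insert (Fin.last m) S)
    rw [Finset.card_insert_of_notMem hS, Fintype.card_fin] at this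
    omega
  rw [sum_powerset_fin_succ m _
    (fun k => -((-1 : ℝ) ^ (m - k) * volume.real ((k : ℝ) • (K : Set F))))
    (fun k => (-1 : ℝ) ^ (m - k) * volume.real ((k : ℝ) • (K : Set F) + (L : Set F)))]
  · refine Finset.sum_congr rfl fun k _ => ?_
    rw [nsmul_eq_mul]
    ring
  · intro S hS
    rw [hsum S hS, coe_nsmul_convexBody, Nat.sub_add_comm (hle S hS), pow_succ]
    ring
  · intro S hS
    rw [Finset.sum_insert hS, hsum S hS, if_pos (by simp), add_comm L, ConvexBody.coe_add,
      coe_nsmul_convexBody, Finset.card_insert_of_notMem hS, Nat.add_sub_add_right]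

/-- The sum is the `m`-th forward difference at `0`, which kills degrees below `m` and sends `X ^ m`
to `m!`. -/
lemma sum_choose_mul_eval {R : ℝ[X]} {m : ℕ} (hR : R.natDegree ≤ m) :
    ∑ k ∈ Finset.range (m + 1), (-1 : ℝ) ^ (m - k) * m.choose k * R.eval (k : ℝ) =
      m.factorial * R.coeff m := by
  have h : (fwdDiff (1 : ℝ))^[m] (fun x => R.eval x) 0 = m.factorial * R.coeff m := by
    rcases hR.eq_or_lt with h | h
    · subst h
      rw [Polynomial.fwdDiff_iter_degree_eq_factorial]
      simp [mul_comm]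
    · rw [Polynomial.fwdDiff_iter_eq_zero_of_degree_lt h, coeff_eq_zero_of_natDegree_lt h]
      simp
  rw [← h, fwdDiff_iter_eq_sum_shift]
  refine Finset.sum_congr rfl fun k _ => ?_
  simp

/-- The mixed volume is read off from the second coefficient of the volume polynomial. -/
lemma mixedVolumePair_eq_coeff {m : ℕ} (hd : Module.finrank ℝ F = m + 1) (K L : ConvexBody F)
    {P : ℝ[X]} (hP : P.natDegree ≤ m + 1) (htop : P.coeff (m + 1) = volume.real (K : Set F))
    (hval : ∀ k : ℕ, volume.real ((k : ℝ) • (K : Set F) + (L : Set F)) = P.eval (k : ℝ)) :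
    mixedVolumePair (m + 1) K L = P.coeff m / (m + 1) := by
  set R : ℝ[X] := P - C (volume.real (K : Set F)) * X ^ (m + 1) with hRdef
  have hR : R.natDegree ≤ m := by
    rw [natDegree_le_iff_coeff_eq_zero]
    intro i hi
    rw [hRdef, coeff_sub, coeff_C_mul_X_pow]
    rcases (Nat.succ_le_of_lt hi).eq_or_lt with h | h
    · rw [if_pos h.symm, ← h, htop, sub_self]
    · rw [if_neg (by omega), coeff_eq_zero_of_natDegree_lt (by omega), sub_zero]
  have hRm : R.coeff m = P.coeff m := by
    rw [hRdef, coeff_sub, coeff_C_mul_X_pow, if_neg (by omega), sub_zero]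
  rw [mixedVolumePair_eq_sum]
  have : ∀ k ∈ Finset.range (m + 1), (-1 : ℝ) ^ (m - k) * m.choose k *
      (volume.real ((k : ℝ) • (K : Set F) + (L : Set F)) - volume.real ((k : ℝ) • (K : Set F))) =
      (-1 : ℝ) ^ (m - k) * m.choose k * R.eval (k : ℝ) := by
    intro k _
    rw [hval, measureReal_smul volume (Nat.cast_nonneg k), hd]
    simp only [hRdef, eval_sub, eval_mul, eval_C, eval_pow, eval_X]
    ring
  rw [Finset.sum_congr rfl this, sum_choose_mul_eval hR, hRm, Nat.factorial_succ]
  have := m.factorial_ne_zero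
  push_cast
  field_simp

/-- Since `s K + L = s (s⁻¹ L + K)`, the polynomials for `s K + L` and `s L + K` are reverses of
each other. The coefficient giving the mixed volume is therefore the derivative at `0` of the volume
of `K + s L`. -/
lemma exists_polynomial_mixedVolumePair {m : ℕ} (hd : Module.finrank ℝ F = m + 1)
    (K L : ConvexBody F) (hK : (interior (K : Set F)).Nonempty)
    (hL : (interior (L : Set F)).Nonempty) :
    ∃ Q : ℝ[X], (∀ s : ℝ, 0 ≤ s → volume.real (s • (L : Set F) + (K : Set F)) = Q.eval s) ∧
      mixedVolumePair (m + 1) K L = Q.coeff 1 / (m + 1) := by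
  obtain ⟨P, hP, hPv⟩ := exists_polynomial_volume_smul_add K.isCompact K.convex hK L.isCompact
    L.convex hL
  obtain ⟨Q, hQ, hQv⟩ := exists_polynomial_volume_smul_add L.isCompact L.convex hL K.isCompact
    K.convex hK
  rw [hd] at hP hQ
  have hPQ : P = reflect (m + 1) Q := by
    refine eq_of_infinite_eval_eq _ _ ((Ioi_infinite (0 : ℝ)).mono fun s (hs : 0 < s) => ?_)
    have hs0 : s⁻¹ ≠ 0 := inv_ne_zero hs.ne'
    let : Invertible s⁻¹ := invertibleOfNonzero hs0
    have h := eval₂_reflect_mul_pow (RingHom.id ℝ) s⁻¹ (m + 1) Q hQ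
    rw [invOf_eq_inv, inv_inv] at h
    simp only [eval₂_id] at h
    have hset : s • (K : Set F) + (L : Set F) = s • (s⁻¹ • (L : Set F) + (K : Set F)) := by
      rw [smul_add, smul_smul, mul_inv_cancel₀ hs.ne', one_smul, add_comm]
    have h2 := hPv s hs.le
    rw [hset, measureReal_smul volume hs.le, hQv _ (by positivity), hd, ← h] at h2
    change P.eval s = _
    rw [← h2, mul_comm, mul_assoc, ← mul_pow, inv_mul_cancel₀ hs.ne', one_pow, mul_one]
  refine ⟨Q, hQv, ?_⟩
  rw [mixedVolumePair_eq_coeff hd K L hP _ fun k => hPv k (Nat.cast_nonneg k)]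
  · rw [hPQ, coeff_reflect, revAt_le (by omega), Nat.add_sub_cancel_left]
  · rw [hPQ, coeff_reflect, revAt_le le_rfl, Nat.sub_self, coeff_zero_eq_eval_zero, ← hQv 0 le_rfl,
      Set.zero_smul_set L.nonempty, zero_add]

/-- **Minkowski's first inequality** with its equality case. -/
theorem minkowski_first {m : ℕ} (hd : Module.finrank ℝ F = m + 1)
    (K L : ConvexBody F) (hK : (interior (K : Set F)).Nonempty)
    (hL : (interior (L : Set F)).Nonempty) {k l : ℝ} (hk : 0 < k) (hl : 0 < l)
    (hKk : volume.real (K : Set F) = k ^ (m + 1)) (hLl : volume.real (L : Set F) = l ^ (m + 1)) :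
    k ^ m * l ≤ mixedVolumePair (m + 1) K L ∧
    (mixedVolumePair (m + 1) K L ≤ k ^ m * l →
      ∃ t : F, ∀ u : F →L[ℝ] ℝ, suppFn (K : Set F) u / k = suppFn (L : Set F) u / l + u t) := by
  obtain ⟨Q, hQ, hV⟩ := exists_polynomial_mixedVolumePair hd K L hK hL
  have hint : (interior ((K : Set F) + (L : Set F))).Nonempty :=
    (hK.add hL).mono subset_interior_add
  have hKLc : IsCompact ((K : Set F) + (L : Set F)) := K.isCompact.add L.isCompact
  have hpos := measureReal_pos_of_interior volume hKLc hint
  set N : ℝ := volume.real ((K : Set F) + (L : Set F)) ^ (((m + 1 : ℕ) : ℝ)⁻¹) with hN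
  have hN0 : 0 < N := Real.rpow_pos_of_pos hpos _
  have hNpow : volume.real ((K : Set F) + (L : Set F)) = N ^ (m + 1) :=
    (Real.rpow_inv_natCast_pow hpos.le (Nat.succ_ne_zero m)).symm
  have hBM := brunnMinkowski volume K.isCompact K.convex hK L.isCompact L.convex hL hk hl
    (by rw [hd, hKk]) (by rw [hd, hLl])
  rw [hd] at hBM
  have hkl : k + l ≤ N := by
    rw [hNpow] at hBM
    exact (pow_le_pow_iff_left₀ (by positivity) hN0.le (Nat.succ_ne_zero m)).1 hBM.1
  -- Write `K + t L = (1 - t) K + t (K + L)` and apply Brunn–Minkowski; both sides agree at `t = 0`,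
  -- so their derivatives compare. Keeping the sharp `N` instead of `k + l` means that equality in
  -- the conclusion yields `N ≤ k + l`, which is equality in Brunn–Minkowski for `K` and `L`.
  have hlow : ∀ t ∈ Ioo (0 : ℝ) 1, ((1 - t) * k + t * N) ^ (m + 1) ≤ Q.eval t := by
    intro t ht
    have ht1 : 0 < 1 - t := by linarith [ht.2]
    have hset : (1 - t) • (K : Set F) + t • ((K : Set F) + (L : Set F)) = t • (L : Set F) + (K : Set F) := by
      rw [smul_add, ← add_assoc, ← K.convex.add_smul ht1.le ht.1.le, sub_add_cancel, one_smul,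
        add_comm]
    have h := (brunnMinkowski volume (K.isCompact.smul (1 - t)) (K.convex.smul (1 - t))
      (by rw [interior_smul₀ ht1.ne']; exact hK.smul_set) (hKLc.smul t)
      ((K.convex.add L.convex).smul t) (by rw [interior_smul₀ ht.1.ne']; exact hint.smul_set)
      (mul_pos ht1 hk) (mul_pos ht.1 hN0)
      (by rw [measureReal_smul volume ht1.le, hKk, hd, mul_pow])
      (by rw [measureReal_smul volume ht.1.le, hNpow, hd, mul_pow])).1
    rwa [hset, hQ t ht.1.le, hd] at h
  have hQ0 : Q.eval 0 = k ^ (m + 1) := by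
    rw [← hQ 0 le_rfl, Set.zero_smul_set L.nonempty, zero_add, hKk]
  have hderiv : HasDerivAt (fun t => Q.eval t - ((1 - t) * k + t * N) ^ (m + 1))
      (Q.coeff 1 - (m + 1) * k ^ m * (N - k)) 0 := by
    have h1 : HasDerivAt (fun t => Q.eval t) (Q.coeff 1) 0 := by
      have := Q.hasDerivAt 0
      rwa [← coeff_zero_eq_eval_zero, coeff_derivative, zero_add, Nat.cast_zero, zero_add,
        mul_one] at this
    have h2 : HasDerivAt (fun t : ℝ => (1 - t) * k + t * N) (N - k) 0 := by
      have := (((hasDerivAt_id (0 : ℝ)).const_sub 1).mul_const k).add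
        ((hasDerivAt_id (0 : ℝ)).mul_const N)
      exact this.congr_deriv (by ring)
    refine (h1.sub (h2.pow (m + 1))).congr_deriv ?_
    simp
  have hcoeff : (m + 1) * k ^ m * (N - k) ≤ Q.coeff 1 := by
    rw [← sub_nonneg]
    refine ge_of_tendsto hderiv.tendsto_slope_zero_right ?_
    filter_upwards [Ioo_mem_nhdsGT (zero_lt_one' ℝ)] with t ht
    have h1 := hlow t ht
    have h2 := ht.1
    simp only [zero_add, hQ0, sub_zero, one_mul, zero_mul, add_zero, sub_self, smul_eq_mul]
    exact mul_nonneg (by positivity) (by linarith)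
  have hVN : k ^ m * (N - k) ≤ mixedVolumePair (m + 1) K L := by
    rw [hV, le_div_iff₀ (by positivity)]
    linarith
  refine ⟨le_trans (by gcongr; linarith) hVN, fun hup => hBM.2 ?_⟩
  have h1 : N - k ≤ l := le_of_mul_le_mul_left (hVN.trans hup) (by positivity)
  rw [hNpow]
  exact pow_le_pow_left₀ hN0.le (by linarith) _

lemma mixedVolumePair_of_homothetic {m : ℕ} (hd : Module.finrank ℝ F = m + 1)
    (K L : ConvexBody F) {c : ℝ} (hc : 0 < c) {t : F} (h : (L : Set F) = c • (K : Set F) + {t}) :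
    mixedVolumePair (m + 1) K L = c * volume.real (K : Set F) := by
  have hdeg : ((X + C c) ^ (m + 1) : ℝ[X]).natDegree = m + 1 := by
    rw [natDegree_pow, natDegree_X_add_C, mul_one]
  rw [mixedVolumePair_eq_coeff hd K L (P := C (volume.real (K : Set F)) * (X + C c) ^ (m + 1))]
  · rw [coeff_C_mul, coeff_X_add_C_pow, Nat.add_sub_cancel_left, pow_one, Nat.choose_succ_self_right]
    push_cast
    field_simp
  · exact (natDegree_C_mul_le _ _).trans hdeg.le
  · rw [coeff_C_mul, coeff_X_add_C_pow]
    simp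
  · intro k
    rw [h, ← add_assoc, ← K.convex.add_smul (Nat.cast_nonneg k) hc.le, add_singleton,
      Measure.real, image_add_right, measure_preimage_add_right,
      ← Measure.real, measureReal_smul volume (by positivity), hd]
    simp [mul_comm]

end MixedVolume

/-! ### Linear images of convex bodies -/

section LinearImages

variable {V F : Type*} [NormedAddCommGroup V] [NormedSpace ℝ V] [NormedAddCommGroup F]
  [InnerProductSpace ℝ F]

/-- The image of convex bodies under a continuous linear map. -/
def mapBody {F : Type*} [NormedAddCommGroup F] [NormedSpace ℝ F] (A : V →L[ℝ] F) :
    ConvexBody V →+ ConvexBody F where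
  toFun K :=
    { carrier := A '' (K : Set V)
      convex' := K.convex.linear_image A.toLinearMap
      isCompact' := K.isCompact.image A.continuous
      nonempty' := K.nonempty.image _ }
  map_zero' := ConvexBody.ext (by simp; rfl)
  map_add' K L := ConvexBody.ext (by simp [image_add])

lemma coe_mapBody {F : Type*} [NormedAddCommGroup F] [NormedSpace ℝ F] (A : V →L[ℝ] F)
    (K : ConvexBody V) : (mapBody A K : Set F) = A '' (K : Set V) := rfl

lemma eventually_notMem_image {Y : Type*} [TopologicalSpace Y] {A : Y → V →L[ℝ] F}
    (hA : Continuous A) {M : Set V} (hM : IsCompact M) {y₀ : Y} {z : F} (hz : z ∉ A y₀ '' M) :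
    ∀ᶠ y in 𝓝 y₀, z ∉ A y '' M := by
  have h := hM.eventually_forall_of_forall_eventually (x₀ := y₀) (P := fun y x => A y x ≠ z) (by
    intro x hx
    have hc : Continuous fun p : Y × V => A p.1 p.2 :=
      isBoundedBilinearMap_apply.continuous.comp ((hA.comp continuous_fst).prodMk continuous_snd)
    exact hc.continuousAt.eventually_ne fun h => hz ⟨x, hx, h⟩)
  filter_upwards [h] with y hy
  rintro ⟨x, hx, hxz⟩
  exact hy x hx hxz

variable [FiniteDimensional ℝ F]

/-- If `f` separated `z` from `A y '' M`, closeness of `A y` to `A y₀` would give `f ≤ ‖f‖ ρ / 2` on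
the ball of radius `ρ`. A vector of length `3ρ/4` along the gradient of `f` refutes this. -/
lemma eventually_mem_image {Y : Type*} [TopologicalSpace Y] {A : Y → V →L[ℝ] F}
    (hA : Continuous A) {M : Set V} (hM : IsCompact M) (hMc : Convex ℝ M) (hne : M.Nonempty)
    {y₀ : Y} {z : F} (hz : z ∈ interior (A y₀ '' M)) :
    ∀ᶠ y in 𝓝 y₀, z ∈ A y '' M := by
  obtain ⟨ρ, hρ, hball⟩ := Metric.isOpen_iff.1 isOpen_interior z hz
  obtain ⟨R, hR, hMR⟩ := hM.isBounded.exists_pos_norm_le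
  have hε : 0 < ρ / 2 / R := by positivity
  have hev : ∀ᶠ y in 𝓝 y₀, A y ∈ Metric.ball (A y₀) (ρ / 2 / R) :=
    hA.continuousAt (Metric.ball_mem_nhds _ hε)
  filter_upwards [hev] with y hy
  by_contra hcon
  obtain ⟨f, u, h1, h2⟩ := geometric_hahn_banach_closed_point
    (hMc.linear_image (A y).toLinearMap) (hM.image (A y).continuous).isClosed hcon
  have h3 : ∀ w : F, ‖w‖ < ρ → f w ≤ ‖f‖ * (ρ / 2) := by
    intro w hw
    obtain ⟨x, hx, hxe⟩ := interior_subset (hball (show z + w ∈ Metric.ball z ρ by simpa using hw))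
    have e1 : f z + f w = f (A y x) + f ((A y₀ - A y) x) := by
      rw [← map_add, ← hxe, ← map_add]; simp
    have e2 : f (A y x) < u := h1 _ ⟨x, hx, rfl⟩
    have e3 : ‖(A y₀ - A y) x‖ ≤ ρ / 2 := by
      have h5 : ‖A y₀ - A y‖ ≤ ρ / 2 / R := by
        rw [← dist_eq_norm, dist_comm]; exact (Metric.mem_ball.1 hy).le
      calc ‖(A y₀ - A y) x‖ ≤ ‖A y₀ - A y‖ * ‖x‖ := (A y₀ - A y).le_opNorm x
        _ ≤ ρ / 2 / R * R := by gcongr; exact hMR x hx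
        _ = ρ / 2 := by field_simp
    have e4 : f ((A y₀ - A y) x) ≤ ‖f‖ * (ρ / 2) :=
      (le_abs_self _).trans ((f.le_opNorm _).trans (by gcongr))
    linarith
  have hf0 : 0 < ‖f‖ := by
    rw [norm_pos_iff]
    rintro rfl
    obtain ⟨x, hx⟩ := hne
    have := h1 _ ⟨x, hx, rfl⟩
    simp at this h2
    linarith
  set v := (InnerProductSpace.toDual ℝ F).symm f with hv
  have hvn : ‖v‖ = ‖f‖ := LinearIsometryEquiv.norm_map _ _
  have hfv : f v = ‖f‖ ^ 2 := by
    have := InnerProductSpace.toDual_symm_apply (x := v) (y := f)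
    rw [← this, ← hv, real_inner_self_eq_norm_sq, hvn]
  have h4 := h3 ((3 / 4 * ρ / ‖f‖) • v) (by
    rw [norm_smul, hvn, Real.norm_of_nonneg (by positivity)]
    field_simp
    norm_num)
  rw [map_smul, hfv, smul_eq_mul] at h4
  have h5 : 3 / 4 * ρ / ‖f‖ * ‖f‖ ^ 2 = ‖f‖ * (3 / 4 * ρ) := by field_simp
  rw [h5] at h4
  have := le_of_mul_le_mul_left h4 hf0
  linarith

variable [MeasurableSpace F] [BorelSpace F]

/-- The volume of a linear image of a convex body depends continuously on the linear map. -/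
lemma continuous_volume_image {Y : Type*} [TopologicalSpace Y] [FirstCountableTopology Y]
    {A : Y → V →L[ℝ] F} (hA : Continuous A) (M : ConvexBody V) :
    Continuous fun y => volume.real (A y '' (M : Set V)) := by
  have hcomp : ∀ y, IsCompact (A y '' (M : Set V)) := fun y => M.isCompact.image (A y).continuous
  have hconv : ∀ y, Convex ℝ (A y '' (M : Set V)) := fun y =>
    M.convex.linear_image (A y).toLinearMap
  have heq : ∀ y, volume.real (A y '' (M : Set V)) =
      ∫ z, (A y '' (M : Set V)).indicator (fun _ => (1 : ℝ)) z := fun y => by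
    rw [integral_indicator (hcomp y).measurableSet]; simp
  simp only [heq]
  rw [continuous_iff_continuousAt]
  intro y₀
  obtain ⟨R, hR, hMR⟩ := M.isBounded.exists_pos_norm_le
  -- The indicators converge at every point off the frontier of `A y₀ '' M`, which is null by
  -- convexity.
  refine continuousAt_of_dominated
    (bound := (Metric.closedBall (0 : F) ((‖A y₀‖ + 1) * R)).indicator fun _ => 1) ?_ ?_ ?_ ?_
  · exact Eventually.of_forall fun y =>
      (stronglyMeasurable_const.indicator (hcomp y).measurableSet).aestronglyMeasurable
  · have hev : ∀ᶠ y in 𝓝 y₀, ‖A y‖ < ‖A y₀‖ + 1 :=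
      hA.norm.continuousAt.eventually_lt continuousAt_const (by simp)
    filter_upwards [hev] with y hy
    refine Eventually.of_forall fun z => ?_
    rw [Real.norm_of_nonneg (indicator_nonneg (fun _ _ => zero_le_one) _)]
    refine indicator_le_indicator_of_subset ?_ (fun _ => zero_le_one) z
    rintro _ ⟨x, hx, rfl⟩
    rw [mem_closedBall_zero_iff]
    refine ((A y).le_opNorm x).trans ?_
    gcongr
    exact hMR x hx
  · rw [integrable_indicator_iff measurableSet_closedBall]
    exact integrableOn_const (isCompact_closedBall _ _).measure_ne_top
  · have hfr : ∀ᵐ z : F, z ∉ frontier (A y₀ '' (M : Set V)) :=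
      measure_eq_zero_iff_ae_notMem.1 ((hconv y₀).addHaar_frontier volume)
    filter_upwards [hfr] with z hz
    by_cases hzm : z ∈ A y₀ '' (M : Set V)
    · have hzi : z ∈ interior (A y₀ '' (M : Set V)) := by
        by_contra h
        exact hz ⟨subset_closure hzm, h⟩
      refine (continuousAt_const (y := (1 : ℝ))).congr ?_
      filter_upwards [eventually_mem_image hA M.isCompact M.convex M.nonempty hzi] with y hy
      rw [indicator_of_mem hy]
    · refine (continuousAt_const (y := (0 : ℝ))).congr ?_
      filter_upwards [eventually_notMem_image hA M.isCompact hzm] with y hy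
      rw [indicator_of_notMem hy]

lemma continuous_mixedVolume_mapBody {Y : Type*} [TopologicalSpace Y] [FirstCountableTopology Y]
    {A : Y → V →L[ℝ] F} (hA : Continuous A) {j : ℕ} (K : Fin j → ConvexBody V) :
    Continuous fun y => mixedVolume fun i => mapBody (A y) (K i) := by
  unfold mixedVolume
  refine continuous_const.mul (continuous_finsetSum _ fun S _ => continuous_const.mul ?_)
  simp only [← map_sum, coe_mapBody]
  exact continuous_volume_image hA _

lemma volume_real_image_isometry {F' : Type*} [NormedAddCommGroup F'] [InnerProductSpace ℝ F']
    [FiniteDimensional ℝ F'] [MeasurableSpace F'] [BorelSpace F'] (e : F ≃ₗᵢ[ℝ] F') (S : Set F) :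
    volume.real (e '' S) = volume.real S := by
  have h := (e.measurePreserving).measure_preimage_emb e.toHomeomorph.measurableEmbedding (e '' S)
  rw [e.injective.preimage_image] at h
  rw [Measure.real, Measure.real, h]

lemma mixedVolume_mapBody_isometry {F' : Type*} [NormedAddCommGroup F'] [InnerProductSpace ℝ F']
    [FiniteDimensional ℝ F'] [MeasurableSpace F'] [BorelSpace F'] (e : F ≃ₗᵢ[ℝ] F') {j : ℕ}
    (K : Fin j → ConvexBody F) :
    mixedVolume (fun i => mapBody (e.toContinuousLinearEquiv : F →L[ℝ] F') (K i)) =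
      mixedVolume K := by
  unfold mixedVolume
  simp only [← map_sum, coe_mapBody]
  congr 1
  refine Finset.sum_congr rfl fun S _ => ?_
  congr 1
  exact volume_real_image_isometry e _

end LinearImages

/-! ### Integration over the Grassmannian -/

section Grassmannian

variable {n j : ℕ}

/-- The projection onto `ξ` after rotation by `g⁻¹`; its images are congruent to projections
onto `g ξ`. -/
def rotProj (ξ : Gr n j) (g : O n) : E n →L[ℝ] ξ.space :=
  ξ.space.orthogonalProjectionOnto ∘L ((g⁻¹ : O n) : E n →L[ℝ] E n)

lemma continuous_rotProj (ξ : Gr n j) : Continuous (rotProj ξ) :=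
  continuous_const.clm_comp (continuous_subtype_val.comp continuous_inv)

lemma linearIsometryEquiv_symm_apply (g : O n) (x : E n) :
    (Unitary.linearIsometryEquiv g).symm x = ((g⁻¹ : O n) : E n →L[ℝ] E n) x := rfl

lemma starProjection_rotate (ξ : Gr n j) (g : O n) (x : E n) :
    (rotate g ξ).space.starProjection x = Unitary.linearIsometryEquiv g (rotProj ξ g x : E n) :=
  Submodule.starProjection_map_apply (Unitary.linearIsometryEquiv g) ξ.space x

lemma surjective_rotProj (ξ : Gr n j) (g : O n) : Function.Surjective (rotProj ξ g) := by
  intro y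
  refine ⟨Unitary.linearIsometryEquiv g y, ?_⟩
  rw [rotProj, ContinuousLinearMap.comp_apply, ← linearIsometryEquiv_symm_apply,
    LinearIsometryEquiv.symm_apply_apply]
  simp

/-- The isometry of `g ξ` onto `ξ` induced by `g⁻¹`. -/
def rotIsometry (ξ : Gr n j) (g : O n) : (rotate g ξ).space ≃ₗᵢ[ℝ] ξ.space :=
  (LinearIsometryEquiv.submoduleMap ξ.space (Unitary.linearIsometryEquiv g)).symm

lemma mapBody_rotIsometry (ξ : Gr n j) (g : O n) (K : ConvexBody (E n)) :
    mapBody ((rotIsometry ξ g).toContinuousLinearEquiv : (rotate g ξ).space →L[ℝ] ξ.space)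
      (proj K (rotate g ξ).space) = mapBody (rotProj ξ g) K := by
  apply ConvexBody.ext
  rw [coe_mapBody, coe_mapBody]
  change _ '' ((rotate g ξ).space.orthogonalProjectionOnto '' (K : Set (E n))) = _
  rw [image_image]
  refine image_congr fun x _ => ?_
  change rotIsometry ξ g _ = _
  have h : (rotIsometry ξ g).symm (rotProj ξ g x) =
      (rotate g ξ).space.orthogonalProjectionOnto x :=
    Subtype.ext (starProjection_rotate ξ g x).symm
  rw [← h]
  exact LinearIsometryEquiv.apply_symm_apply _ _

lemma mixedVolume_proj_rotate {i : ℕ} (ξ : Gr n j) (g : O n) (K : Fin i → ConvexBody (E n)) :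
    mixedVolume (fun a => proj (K a) (rotate g ξ).space) =
      mixedVolume fun a => mapBody (rotProj ξ g) (K a) := by
  rw [← mixedVolume_mapBody_isometry (rotIsometry ξ g)]
  simp only [mapBody_rotIsometry]

lemma volume_proj_rotate (ξ : Gr n j) (g : O n) (K : ConvexBody (E n)) :
    volume.real (proj K (rotate g ξ).space : Set (rotate g ξ).space) =
      volume.real (rotProj ξ g '' (K : Set (E n))) := by
  rw [← volume_real_image_isometry (rotIsometry ξ g)]
  congr 1
  exact congrArg (fun M : ConvexBody ξ.space => (M : Set ξ.space)) (mapBody_rotIsometry ξ g K)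

/-- The orthogonal group acts transitively on the Grassmannian. -/
lemma surjective_rotate (ξ : Gr n j) : Function.Surjective fun g : O n => rotate g ξ := by
  intro η
  let e : ξ.space ≃ₗᵢ[ℝ] η.space := (stdOrthonormalBasis ℝ ξ.space).equiv
    (stdOrthonormalBasis ℝ η.space) (finCongr (ξ.finrank_eq.trans η.finrank_eq.symm))
  let f : E n →ₗᵢ[ℝ] E n := (η.space.subtypeₗᵢ.comp e.toLinearIsometry).extend
  let f' : E n ≃ₗᵢ[ℝ] E n := f.toLinearIsometryEquiv rfl
  refine ⟨Unitary.linearIsometryEquiv.symm f', ?_⟩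
  have hsp : (rotate (Unitary.linearIsometryEquiv.symm f') ξ).space = η.space := by
    change ξ.space.map _ = _
    rw [MulEquiv.apply_symm_apply]
    have hf : ∀ x : ξ.space, f' (x : E n) = e x := fun x => LinearIsometry.extend_apply _ x
    apply le_antisymm
    · rintro _ ⟨x, hx, rfl⟩
      have := hf ⟨x, hx⟩
      change f' x ∈ η.space
      rw [this]
      exact (e ⟨x, hx⟩).2
    · intro y hy
      refine ⟨e.symm ⟨y, hy⟩, (e.symm ⟨y, hy⟩).2, ?_⟩
      change f' _ = y
      rw [hf]
      simp
  cases η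
  cases hr : rotate (Unitary.linearIsometryEquiv.symm f') ξ
  simp_all

instance : T2Space (Gr n j) := by
  have h : IsEmbedding fun ξ : Gr n j => ξ.space.starProjection := by
    refine ⟨⟨rfl⟩, fun ξ η h => ?_⟩
    have := Submodule.starProjection_inj.1 h
    cases ξ
    cases η
    simp_all
  exact h.t2Space

/-- A continuous surjection from a compact to a Hausdorff space is a quotient map, so continuity on
the Grassmannian can be tested on `O n`. There all projections live in one fixed space `ξ` and vary
through the continuous family `rotProj ξ`. -/
lemma isQuotientMap_rotate (ξ : Gr n j) : IsQuotientMap fun g : O n => rotate g ξ :=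
  (continuous_rotate ξ).isClosedMap.isQuotientMap (continuous_rotate ξ) (surjective_rotate ξ)

lemma integral_grMeasure (hj : j ≤ n) {f : Gr n j → ℝ}
    (hf : Continuous fun g : O n => f (rotate g (coordSubspace hj))) :
    ∫ ξ, f ξ ∂(grMeasure hj) = ∫ g, f (rotate g (coordSubspace hj)) ∂(haarO n) := by
  have hc : Continuous f := (isQuotientMap_rotate (coordSubspace hj)).continuous_iff.2 hf
  exact integral_map (continuous_rotate _).measurable.aemeasurable hc.aestronglyMeasurable

end Grassmannian

/-! ### Hölder's inequality for continuous functions, with equality case -/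

lemma integral_le_rpow_mul_rpow_of_le {X : Type*} [TopologicalSpace X] [CompactSpace X]
    [MeasurableSpace X] [BorelSpace X] (μ : Measure X) [IsProbabilityMeasure μ]
    [μ.IsOpenPosMeasure] {P Q M : X → ℝ} (hP : Continuous P) (hQ : Continuous Q)
    (hM : Continuous M) (hP0 : ∀ x, 0 < P x) (hQ0 : ∀ x, 0 < Q x) {w : ℝ} (hw0 : 0 < w)
    (hw1 : w < 1) (hle : ∀ x, M x ≤ P x ^ (1 - w) * Q x ^ w)
    (hIP : 0 < ∫ x, P x ∂μ) (hIQ : 0 < ∫ x, Q x ∂μ) :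
    ∫ x, M x ∂μ ≤ (∫ x, P x ∂μ) ^ (1 - w) * (∫ x, Q x ∂μ) ^ w ∧
    (∫ x, M x ∂μ = (∫ x, P x ∂μ) ^ (1 - w) * (∫ x, Q x ∂μ) ^ w →
      ∀ x, M x = P x ^ (1 - w) * Q x ^ w ∧ P x / ∫ x, P x ∂μ = Q x / ∫ x, Q x ∂μ) := by
  set a := ∫ x, P x ∂μ
  set b := ∫ x, Q x ∂μ
  have hint : ∀ {f : X → ℝ}, Continuous f → Integrable f μ := fun hf =>
    hf.integrable_of_hasCompactSupport (HasCompactSupport.of_compactSpace _)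
  have hab : 0 < a ^ (1 - w) * b ^ w := by positivity
  set Y := a ^ (1 - w) * b ^ w with hY
  have hgeom : ∀ x, P x ^ (1 - w) * Q x ^ w / Y = (P x / a) ^ (1 - w) * (Q x / b) ^ w := by
    intro x
    rw [Real.div_rpow (hP0 x).le hIP.le, Real.div_rpow (hQ0 x).le hIQ.le, hY]
    field_simp
  have hamgm : ∀ x, P x ^ (1 - w) * Q x ^ w / Y ≤ (1 - w) * (P x / a) + w * (Q x / b) := by
    intro x
    rw [hgeom]
    exact Real.geom_mean_le_arith_mean2_weighted (by linarith) hw0.le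
      (div_pos (hP0 x) hIP).le (div_pos (hQ0 x) hIQ).le (by ring)
  -- `D` is the gap between the arithmetic mean of the normalized `P`, `Q` and the normalized `M`.
  -- In the equality case its integral is zero, so by continuity and full support it vanishes
  -- everywhere, forcing equality both in `hle` and in AM-GM.
  set D : X → ℝ := fun x => (1 - w) * (P x / a) + w * (Q x / b) - M x / Y with hD
  have hDc : Continuous D := by fun_prop
  have hD0 : ∀ x, 0 ≤ D x := by
    intro x
    have h1 : M x / Y ≤ P x ^ (1 - w) * Q x ^ w / Y := by gcongr; exact hle x
    simp only [hD]
    linarith [hamgm x]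
  have hDint : ∫ x, D x ∂μ = 1 - (∫ x, M x ∂μ) / Y := by
    simp only [hD]
    rw [integral_sub (hint (by fun_prop)) (hint (by fun_prop)),
      integral_add (hint (by fun_prop)) (hint (by fun_prop)), integral_const_mul,
      integral_const_mul, integral_div, integral_div, integral_div, div_self hIP.ne',
      div_self hIQ.ne']
    ring
  constructor
  · have h := integral_nonneg (μ := μ) (f := D) hD0
    rw [hDint, sub_nonneg, div_le_one hab] at h
    exact h
  · intro heq x
    rw [heq, div_self hab.ne', sub_self, integral_eq_zero_iff_of_nonneg hD0 (hint hDc)] at hDint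
    have hz : D x = 0 := congrFun ((Continuous.ae_eq_iff_eq μ hDc continuous_zero).1 hDint) x
    have h1 : M x / Y ≤ P x ^ (1 - w) * Q x ^ w / Y := by gcongr; exact hle x
    have h2 := hamgm x
    simp only [hD] at hz
    have h3 : M x / Y = P x ^ (1 - w) * Q x ^ w / Y := by linarith
    refine ⟨by rwa [div_left_inj' hab.ne'] at h3, ?_⟩
    have h4 : P x ^ (1 - w) * Q x ^ w / Y = (1 - w) * (P x / a) + w * (Q x / b) := by linarith
    rw [hgeom] at h4
    exact eq_of_geom_mean_eq_arith_mean hw0 hw1 (div_pos (hP0 x) hIP).le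
      (div_pos (hQ0 x) hIQ).le h4

/-! ### Reconstruction of a homothety from projections -/

lemma exists_le_finrank_eq {V : Type*} [AddCommGroup V] [Module ℝ V] [FiniteDimensional ℝ V]
    (W : Submodule ℝ V) {j : ℕ} (hW : Module.finrank ℝ W ≤ j) (hj : j ≤ Module.finrank ℝ V) :
    ∃ ξ : Submodule ℝ V, W ≤ ξ ∧ Module.finrank ℝ ξ = j := by
  induction j, hW using Nat.le_induction with
  | base => exact ⟨W, le_rfl, rfl⟩
  | succ k _ ih =>
    obtain ⟨ξ, hξ, hk⟩ := ih (by omega)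
    have hne : ξ ≠ ⊤ := fun h => by
      rw [h, finrank_top] at hk; omega
    obtain ⟨v, hv⟩ : ∃ v, v ∉ ξ := by
      by_contra! h
      exact hne (Submodule.eq_top_iff'.2 h)
    exact ⟨ξ ⊔ Submodule.span ℝ {v}, hξ.trans le_sup_left, by
      rw [Submodule.finrank_sup_span_singleton hv, hk]⟩

lemma suppFn_add_singleton {V : Type*} [NormedAddCommGroup V] [NormedSpace ℝ V] {K : Set V}
    (hK : IsCompact K) (hne : K.Nonempty) (t : V) (u : V →L[ℝ] ℝ) :
    suppFn (K + {t}) u = suppFn K u + u t := by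
  have hc : IsCompact (K + {t}) := hK.add isCompact_singleton
  apply le_antisymm
  · obtain ⟨x, ⟨y, hy, s, hs, rfl⟩, hx⟩ := exists_suppFn_eq hc (hne.add (singleton_nonempty t)) u
    rw [hx, mem_singleton_iff.1 hs, map_add]
    gcongr
    exact le_suppFn hK u hy
  · obtain ⟨y, hy, h⟩ := exists_suppFn_eq hK hne u
    rw [h, ← map_add]
    exact le_suppFn hc u ⟨y, hy, t, rfl, rfl⟩

section Reconstruction

open scoped RealInnerProductSpace

variable {n j : ℕ}

/-- For `a` in `g ξ` the functional `⟪a, ·⟫` factors through the projection, so the support function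
of a body in direction `a` is one of its projection. -/
lemma innerSL_eq_comp_rotProj (ξ : Gr n j) (g : O n) {a : E n} (ha : a ∈ (rotate g ξ).space) :
    innerSL ℝ a = ((innerSL ℝ a) ∘L ((g : E n →L[ℝ] E n) ∘L ξ.space.subtypeL)) ∘L
      rotProj ξ g := by
  ext1 x
  have h := starProjection_rotate ξ g x
  change ⟪a, x⟫ = ⟪a, Unitary.linearIsometryEquiv g (rotProj ξ g x : E n)⟫
  rw [← h, ← Submodule.inner_starProjection_left_eq_right,
    Submodule.starProjection_eq_self_iff.2 ha]

/-- If the projections of `K` are translates of those of `c L`, then so is `K`. -/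
lemma homothetic_of_rotProj (hj2 : 2 ≤ j) (hjn : j ≤ n) (ξ : Gr n j) (K L : ConvexBody (E n))
    {c : ℝ} (hc : 0 < c)
    (h : ∀ g : O n, ∃ t : ξ.space, ∀ u : ξ.space →L[ℝ] ℝ,
      suppFn (rotProj ξ g '' (K : Set (E n))) u =
        c * suppFn (rotProj ξ g '' (L : Set (E n))) u + u t) :
    Homothetic K L := by
  set D : E n → ℝ := fun a =>
    suppFn (K : Set (E n)) (innerSL ℝ a) - c * suppFn (L : Set (E n)) (innerSL ℝ a) with hD
  -- A subspace of dimension at most two lies in some `g ξ` because `j ≥ 2`, and `D` is linear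
  -- there. Additivity and homogeneity of `D` involve at most two vectors, so this suffices for
  -- global linearity.
  have hloc : ∀ W : Submodule ℝ (E n), Module.finrank ℝ W ≤ 2 →
      ∃ s : E n, ∀ a ∈ W, D a = ⟪a, s⟫ := by
    intro W hW
    obtain ⟨η, hWη, hη⟩ := exists_le_finrank_eq W (hW.trans hj2)
      (by rw [finrank_euclideanSpace_fin]; exact hjn)
    obtain ⟨g, hg⟩ := surjective_rotate ξ ⟨η, hη⟩
    simp only at hg
    obtain ⟨t, ht⟩ := h g
    refine ⟨(g : E n →L[ℝ] E n) t, fun a ha => ?_⟩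
    have hag : a ∈ (rotate g ξ).space := by rw [hg]; exact hWη ha
    have h1 := ht ((innerSL ℝ a) ∘L ((g : E n →L[ℝ] E n) ∘L ξ.space.subtypeL))
    rw [suppFn_image, suppFn_image, ← innerSL_eq_comp_rotProj ξ g hag] at h1
    simp only [hD]
    rw [h1, add_sub_cancel_left]
    rfl
  have hspan : ∀ a b : E n, Module.finrank ℝ (Submodule.span ℝ {a, b}) ≤ 2 := by
    intro a b
    classical
    have := finrank_span_finset_le_card (R := ℝ) ({a, b} : Finset (E n))
    rw [Finset.coe_pair] at this
    exact this.trans Finset.card_le_two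
  let D' : E n →ₗ[ℝ] ℝ :=
    { toFun := D
      map_add' := fun a b => by
        obtain ⟨s, hs⟩ := hloc _ (hspan a b)
        have ha : a ∈ Submodule.span ℝ {a, b} := Submodule.subset_span (by simp)
        have hb : b ∈ Submodule.span ℝ {a, b} := Submodule.subset_span (by simp)
        rw [hs a ha, hs b hb, hs _ (add_mem ha hb), inner_add_left]
      map_smul' := fun r a => by
        obtain ⟨s, hs⟩ := hloc _ (hspan a a)
        have ha : a ∈ Submodule.span ℝ {a, a} := Submodule.subset_span (by simp)
        rw [hs a ha, hs _ (Submodule.smul_mem _ r ha), real_inner_smul_left]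
        simp }
  set t : E n := (InnerProductSpace.toDual ℝ (E n)).symm (LinearMap.toContinuousLinearMap D')
    with ht
  have hDt : ∀ a, D a = ⟪t, a⟫ := by
    intro a
    rw [ht, InnerProductSpace.toDual_symm_apply]
    rfl
  have hsupp : ∀ u : E n →L[ℝ] ℝ, suppFn (K : Set (E n)) u =
      suppFn (c • (L : Set (E n)) + {t}) u := by
    intro u
    obtain ⟨a, rfl⟩ : ∃ a, innerSL ℝ a = u :=
      ⟨(InnerProductSpace.toDual ℝ (E n)).symm u, by
        ext1 x; rw [innerSL_apply_apply, InnerProductSpace.toDual_symm_apply]⟩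
    rw [suppFn_add_singleton (L.isCompact.smul c) L.nonempty.smul_set, suppFn_smul hc.le]
    have := hDt a
    simp only [hD] at this
    rw [innerSL_apply_apply, real_inner_comm]
    linarith
  have hLc : IsCompact (c • (L : Set (E n)) + {t}) :=
    (L.isCompact.smul c).add isCompact_singleton
  refine ⟨c, hc, t, Subset.antisymm ?_ ?_⟩
  · exact subset_of_suppFn_le K.isCompact hLc ((L.convex.smul c).add (convex_singleton t))
      (L.nonempty.smul_set.add (singleton_nonempty t)) fun u => (hsupp u).le
  · exact subset_of_suppFn_le hLc K.isCompact K.convex K.nonempty fun u => (hsupp u).ge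

end Reconstruction

/-! ### The inequality for affine quermassintegrals -/

lemma omega_pos (k : ℕ) : 0 < omega k :=
  measureReal_pos_of_interior volume (isCompact_closedBall _ _)
    ⟨0, Metric.ball_subset_interior_closedBall (Metric.mem_ball_self one_pos)⟩

instance (n : ℕ) : (haarO n).IsOpenPosMeasure := by
  unfold haarO; infer_instance

/-- Minkowski's first inequality, written with real powers of the volumes. -/
lemma minkowski_first_rpow {F : Type*} [NormedAddCommGroup F] [InnerProductSpace ℝ F]
    [FiniteDimensional ℝ F] [MeasurableSpace F] [BorelSpace F] {m : ℕ}
    (hd : Module.finrank ℝ F = m + 1) (K L : ConvexBody F)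
    (hK : (interior (K : Set F)).Nonempty) (hL : (interior (L : Set F)).Nonempty)
    {w : ℝ} (hw : w = ((m + 1 : ℕ) : ℝ)⁻¹) :
    volume.real (K : Set F) ^ (1 - w) * volume.real (L : Set F) ^ w ≤
      mixedVolumePair (m + 1) K L ∧
    (mixedVolumePair (m + 1) K L ≤
        volume.real (K : Set F) ^ (1 - w) * volume.real (L : Set F) ^ w →
      ∃ t : F, ∀ u : F →L[ℝ] ℝ, suppFn (K : Set F) u =
        (volume.real (K : Set F) / volume.real (L : Set F)) ^ w * suppFn (L : Set F) u + u t) := by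
  have hp := measureReal_pos_of_interior volume K.isCompact hK
  have hq := measureReal_pos_of_interior volume L.isCompact hL
  have hroot : ∀ {x : ℝ}, 0 < x → x = (x ^ w) ^ (m + 1) := fun hx => by
    rw [hw, Real.rpow_inv_natCast_pow hx.le (Nat.succ_ne_zero m)]
  have hkm : (volume.real (K : Set F) ^ w) ^ m = volume.real (K : Set F) ^ (1 - w) := by
    rw [← Real.rpow_natCast, ← Real.rpow_mul hp.le]
    congr 1
    rw [hw]
    push_cast
    field_simp
    ring
  have hk := Real.rpow_pos_of_pos hp w
  have hl := Real.rpow_pos_of_pos hq w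
  have h := minkowski_first hd K L hK hL hk hl (hroot hp) (hroot hq)
  rw [hkm] at h
  refine ⟨h.1, fun hup => ?_⟩
  obtain ⟨t, ht⟩ := h.2 hup
  refine ⟨volume.real (K : Set F) ^ w • t, fun u => ?_⟩
  have := ht u
  rw [Real.div_rpow hp.le hq.le, map_smul, smul_eq_mul]
  field_simp at this ⊢
  linarith

/-- The mean of order `-n` in the definition of the affine quermassintegrals turns products of
powers into products. -/
lemma affine_mean_mul {ω a b w : ℝ} {m n : ℕ} (ha : 0 < a) (hb : 0 < b)
    (hw : w = ((m + 1 : ℕ) : ℝ)⁻¹) :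
    (ω * a ^ (-1 / (n : ℝ))) ^ m * (ω * b ^ (-1 / (n : ℝ))) =
      (ω * (a ^ (1 - w) * b ^ w) ^ (-1 / (n : ℝ))) ^ (m + 1) := by
  have h1 : ((a ^ (1 - w)) ^ (-1 / (n : ℝ))) ^ (m + 1) = (a ^ (-1 / (n : ℝ))) ^ m := by
    rw [← Real.rpow_natCast, ← Real.rpow_natCast, ← Real.rpow_mul ha.le, ← Real.rpow_mul ha.le,
      ← Real.rpow_mul ha.le]
    congr 1
    rw [hw]
    push_cast
    have : (m : ℝ) + 1 ≠ 0 := by positivity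
    field_simp
    ring
  have h2 : ((b ^ w) ^ (-1 / (n : ℝ))) ^ (m + 1) = b ^ (-1 / (n : ℝ)) := by
    rw [← Real.rpow_natCast, ← Real.rpow_mul hb.le, ← Real.rpow_mul hb.le]
    congr 1
    rw [hw]
    push_cast
    have : (m : ℝ) + 1 ≠ 0 := by positivity
    field_simp
  rw [Real.mul_rpow (by positivity) (by positivity), mul_pow, mul_pow, mul_pow, h1, h2]
  ring

lemma affine_mean_le_iff {ω a b : ℝ} {m n : ℕ} (hω : 0 < ω) (hn : 1 ≤ n) (ha : 0 < a)
    (hb : 0 < b) :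
    (ω * a ^ (-1 / (n : ℝ))) ^ (m + 1) ≤ (ω * b ^ (-1 / (n : ℝ))) ^ (m + 1) ↔ b ≤ a := by
  rw [pow_le_pow_iff_left₀ (by positivity) (by positivity) (Nat.succ_ne_zero m),
    mul_le_mul_iff_right₀ hω]
  exact Real.rpow_le_rpow_iff_of_neg ha hb (by
    have : (0 : ℝ) < n := by exact_mod_cast hn
    exact div_neg_of_neg_of_pos (by norm_num) this)

/-- The mean of order `-n` of `f / ω`, scaled by `Ω`. -/
def affineMean {X : Type*} [MeasurableSpace X] (μ : Measure X) (Ω ω : ℝ) (n : ℕ) (f : X → ℝ) : ℝ :=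
  Ω * (∫ x, (f x / ω) ^ (-(n : ℝ)) ∂μ) ^ (-1 / (n : ℝ))

lemma affineMean_const_mul {X : Type*} [MeasurableSpace X] {μ : Measure X} {Ω ω : ℝ} {n : ℕ}
    (hn : 1 ≤ n) (hω : 0 < ω) {f : X → ℝ} (hf0 : ∀ x, 0 < f x) {c : ℝ} (hc : 0 < c) :
    affineMean μ Ω ω n (fun x => c * f x) = c * affineMean μ Ω ω n f := by
  have hn0 : (n : ℝ) ≠ 0 := by exact_mod_cast (Nat.one_le_iff_ne_zero.1 hn)
  have h : ∀ x, (c * f x / ω) ^ (-(n : ℝ)) = c ^ (-(n : ℝ)) * (f x / ω) ^ (-(n : ℝ)) := fun x => by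
    rw [mul_div_assoc, Real.mul_rpow hc.le (div_pos (hf0 x) hω).le]
  have hI : 0 ≤ ∫ x, (f x / ω) ^ (-(n : ℝ)) ∂μ :=
    integral_nonneg fun x => Real.rpow_nonneg (div_pos (hf0 x) hω).le _
  have he : -(n : ℝ) * (-1 / (n : ℝ)) = 1 := by field_simp
  simp only [affineMean, h]
  rw [integral_const_mul, Real.mul_rpow (Real.rpow_nonneg hc.le _) hI, ← Real.rpow_mul hc.le, he,
    Real.rpow_one]
  ring

lemma continuous_div_rpow {X : Type*} [TopologicalSpace X] {ω : ℝ} {n : ℕ} (hω : 0 < ω)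
    {f : X → ℝ} (hf : Continuous f) (hf0 : ∀ x, 0 < f x) :
    Continuous fun x => (f x / ω) ^ (-(n : ℝ)) :=
  (hf.div_const _).rpow_const fun x => Or.inl (div_pos (hf0 x) hω).ne'

/-! ### Hölder's inequality for means of order `-n` -/

section AffineMean

variable {X : Type*} [TopologicalSpace X] [CompactSpace X] [MeasurableSpace X] [BorelSpace X]
  {μ : Measure X} [IsProbabilityMeasure μ] [μ.IsOpenPosMeasure] {Ω ω : ℝ} {n : ℕ}

lemma integral_div_rpow_pos (hω : 0 < ω) {f : X → ℝ} (hf : Continuous f) (hf0 : ∀ x, 0 < f x) :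
    0 < ∫ x, (f x / ω) ^ (-(n : ℝ)) ∂μ := by
  obtain ⟨x⟩ : Nonempty X := nonempty_of_isProbabilityMeasure μ
  have h : ∀ x, 0 < (f x / ω) ^ (-(n : ℝ)) := fun x => Real.rpow_pos_of_pos (div_pos (hf0 x) hω) _
  exact (continuous_div_rpow hω hf hf0).integral_pos_of_hasCompactSupport_nonneg_nonzero
    (HasCompactSupport.of_compactSpace _) (fun x => (h x).le) (h x).ne'

/-- A pointwise lower bound by a geometric mean passes to the means of order `-n`; in the equality
case the bound is attained everywhere and the two functions are proportional. -/
theorem affineMean_geom_mean_le (hn : 1 ≤ n) (hΩ : 0 < Ω) (hω : 0 < ω) {m : ℕ} (hm : 1 ≤ m)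
    {p q v : X → ℝ} (hp : Continuous p) (hq : Continuous q) (hv : Continuous v)
    (hp0 : ∀ x, 0 < p x) (hq0 : ∀ x, 0 < q x) {w : ℝ} (hw : w = ((m + 1 : ℕ) : ℝ)⁻¹)
    (hle : ∀ x, p x ^ (1 - w) * q x ^ w ≤ v x) :
    affineMean μ Ω ω n p ^ m * affineMean μ Ω ω n q ≤ affineMean μ Ω ω n v ^ (m + 1) ∧
    (affineMean μ Ω ω n v ^ (m + 1) = affineMean μ Ω ω n p ^ m * affineMean μ Ω ω n q →
      (∀ x, v x ≤ p x ^ (1 - w) * q x ^ w) ∧ ∀ x y, p x / q x = p y / q y) := by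
  have hw0 : 0 < w := by rw [hw]; positivity
  have hw1 : w < 1 := by
    rw [hw]
    exact inv_lt_one_of_one_lt₀ (by exact_mod_cast Nat.lt_succ_of_le hm)
  have hn0 : (0 : ℝ) < n := by exact_mod_cast hn
  have hgm0 : ∀ x, 0 < p x ^ (1 - w) * q x ^ w := fun x =>
    mul_pos (Real.rpow_pos_of_pos (hp0 x) _) (Real.rpow_pos_of_pos (hq0 x) _)
  have hv0 : ∀ x, 0 < v x := fun x => (hgm0 x).trans_le (hle x)
  have hIP := integral_div_rpow_pos (μ := μ) (n := n) hω hp hp0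
  have hIQ := integral_div_rpow_pos (μ := μ) (n := n) hω hq hq0
  have hIM := integral_div_rpow_pos (μ := μ) (n := n) hω hv hv0
  have hgm : ∀ x, ((p x / ω) ^ (-(n : ℝ))) ^ (1 - w) * ((q x / ω) ^ (-(n : ℝ))) ^ w =
      ((p x ^ (1 - w) * q x ^ w) / ω) ^ (-(n : ℝ)) := by
    intro x
    have e1 : (p x ^ (1 - w) * q x ^ w) / ω = (p x / ω) ^ (1 - w) * (q x / ω) ^ w := by
      rw [Real.div_rpow (hp0 x).le hω.le, Real.div_rpow (hq0 x).le hω.le, div_mul_div_comm,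
        ← Real.rpow_add hω, sub_add_cancel, Real.rpow_one]
    have e2 := (div_pos (hp0 x) hω).le
    have e3 := (div_pos (hq0 x) hω).le
    rw [e1, Real.mul_rpow (Real.rpow_nonneg e2 _) (Real.rpow_nonneg e3 _),
      ← Real.rpow_mul e2, ← Real.rpow_mul e2, ← Real.rpow_mul e3, ← Real.rpow_mul e3,
      mul_comm (-(n : ℝ)), mul_comm (-(n : ℝ))]
  -- The power `-n` turns the lower bound for `v` into the upper bound that Hölder needs; the outer
  -- power `-1/n` reverses the inequality back.
  have hleM : ∀ x, (v x / ω) ^ (-(n : ℝ)) ≤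
      ((p x / ω) ^ (-(n : ℝ))) ^ (1 - w) * ((q x / ω) ^ (-(n : ℝ))) ^ w := by
    intro x
    rw [hgm]
    exact Real.rpow_le_rpow_of_nonpos (div_pos (hgm0 x) hω)
      (div_le_div_of_nonneg_right (hle x) hω.le) (by linarith)
  have hHol := integral_le_rpow_mul_rpow_of_le μ (continuous_div_rpow hω hp hp0)
    (continuous_div_rpow hω hq hq0) (continuous_div_rpow hω hv hv0)
    (fun x => Real.rpow_pos_of_pos (div_pos (hp0 x) hω) _)
    (fun x => Real.rpow_pos_of_pos (div_pos (hq0 x) hω) _) hw0 hw1 hleM hIP hIQ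
  have hY := mul_pos (Real.rpow_pos_of_pos hIP (1 - w)) (Real.rpow_pos_of_pos hIQ w)
  unfold affineMean
  rw [affine_mean_mul hIP hIQ hw]
  refine ⟨(affine_mean_le_iff hΩ hn hY hIM).2 hHol.1, fun heq => ?_⟩
  have hpt := hHol.2 (le_antisymm hHol.1 ((affine_mean_le_iff hΩ hn hIM hY).1 heq.le))
  refine ⟨fun x => ?_, fun x y => ?_⟩
  · have h := (hpt x).1
    rw [hgm] at h
    have h' := (Real.rpow_left_inj (div_pos (hv0 x) hω).le (div_pos (hgm0 x) hω).le
      (neg_ne_zero.2 hn0.ne')).1 h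
    rw [div_left_inj' hω.ne'] at h'
    exact h'.le
  · have h1 : ∀ x, (p x / q x) ^ (-(n : ℝ)) =
        (∫ x, (p x / ω) ^ (-(n : ℝ)) ∂μ) / ∫ x, (q x / ω) ^ (-(n : ℝ)) ∂μ := by
      intro x
      have h2 := (hpt x).2
      have h3 : (p x / q x) ^ (-(n : ℝ)) = (p x / ω) ^ (-(n : ℝ)) / (q x / ω) ^ (-(n : ℝ)) := by
        rw [← Real.div_rpow (div_pos (hp0 x) hω).le (div_pos (hq0 x) hω).le,
          div_div_div_cancel_right₀ hω.ne']
      rw [h3, div_eq_div_iff (Real.rpow_pos_of_pos (div_pos (hq0 x) hω) _).ne' hIQ.ne']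
      rw [div_eq_div_iff hIP.ne' hIQ.ne'] at h2
      linarith
    exact (Real.rpow_left_inj (div_pos (hp0 x) (hq0 x)).le (div_pos (hp0 y) (hq0 y)).le
      (neg_ne_zero.2 hn0.ne')).1 ((h1 x).trans (h1 y).symm)

end AffineMean

/-! ### Affine quermassintegrals as means over the orthogonal group -/

section Quermass

variable {n j : ℕ}

lemma interior_rotProj_image (ξ : Gr n j) (g : O n) {K : Set (E n)} (hK : (interior K).Nonempty) :
    (interior (rotProj ξ g '' K)).Nonempty :=
  (hK.image _).mono (((rotProj ξ g).isOpenMap (surjective_rotProj ξ g)).image_interior_subset K)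

lemma Phi_eq_integral (hj : j ≤ n) (K : ConvexBody (E n))
    (hK : (interior (K : Set (E n))).Nonempty) :
    Phi hj K = omega n * (∫ g : O n,
      (volume.real (rotProj (coordSubspace hj) g '' (K : Set (E n))) / omega j) ^ (-(n : ℝ))
        ∂(haarO n)) ^ (-1 / (n : ℝ)) := by
  rw [Phi, integral_grMeasure hj]
  · simp only [volume_proj_rotate]
  · simp only [volume_proj_rotate]
    refine ((continuous_volume_image (continuous_rotProj _) K).div_const _).rpow_const
      fun g => Or.inl ?_
    exact (div_pos (measureReal_pos_of_interior volume
      (K.isCompact.image (rotProj _ g).continuous) (interior_rotProj_image _ g hK))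
      (omega_pos j)).ne'

lemma mixedVolume_proj_pair (ξ : Gr n j) (g : O n) (K L : ConvexBody (E n)) :
    mixedVolume (fun i : Fin j => proj (if (i : ℕ) + 1 = j then L else K) (rotate g ξ).space) =
      mixedVolumePair j (mapBody (rotProj ξ g) K) (mapBody (rotProj ξ g) L) := by
  rw [mixedVolume_proj_rotate ξ g fun i : Fin j => if (i : ℕ) + 1 = j then L else K]
  simp only [apply_ite (mapBody (rotProj ξ g))]
  rfl

lemma continuous_mixedVolumePair (ξ : Gr n j) (K L : ConvexBody (E n)) :
    Continuous fun g => mixedVolumePair j (mapBody (rotProj ξ g) K) (mapBody (rotProj ξ g) L) := by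
  have := continuous_mixedVolume_mapBody (continuous_rotProj ξ)
    fun i : Fin j => if (i : ℕ) + 1 = j then L else K
  simp only [apply_ite (mapBody (rotProj ξ _))] at this
  exact this

lemma Phi₁_eq_integral (hj : j ≤ n) (K L : ConvexBody (E n))
    (hpos : ∀ g, 0 < mixedVolumePair j (mapBody (rotProj (coordSubspace hj) g) K)
      (mapBody (rotProj (coordSubspace hj) g) L)) :
    Phi₁ hj K L = omega n * (∫ g : O n,
      (mixedVolumePair j (mapBody (rotProj (coordSubspace hj) g) K)
        (mapBody (rotProj (coordSubspace hj) g) L) / omega j) ^ (-(n : ℝ))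
        ∂(haarO n)) ^ (-1 / (n : ℝ)) := by
  rw [Phi₁, mixedPhi, integral_grMeasure hj]
  · simp only [mixedVolume_proj_pair]
  · simp only [mixedVolume_proj_pair]
    exact ((continuous_mixedVolumePair _ K L).div_const _).rpow_const
      fun g => Or.inl (div_pos (hpos g) (omega_pos j)).ne'

lemma mixedVolumePair_one {F : Type*} [NormedAddCommGroup F] [InnerProductSpace ℝ F]
    [FiniteDimensional ℝ F] [MeasurableSpace F] [BorelSpace F] (hd : Module.finrank ℝ F = 1)
    (K L : ConvexBody F) : mixedVolumePair 1 K L = volume.real (L : Set F) := by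
  rw [mixedVolumePair_eq_sum 0]
  simp [measureReal_smul, hd, Set.zero_smul_set K.nonempty]

lemma Homothetic.symm_eq {K L : ConvexBody (E n)} {c : ℝ} (hc : 0 < c) {t : E n}
    (h : (K : Set (E n)) = c • (L : Set (E n)) + {t}) :
    (L : Set (E n)) = c⁻¹ • (K : Set (E n)) + {-(c⁻¹ • t)} := by
  rw [h, smul_add, smul_smul, inv_mul_cancel₀ hc.ne', one_smul, smul_set_singleton, add_assoc,
    singleton_add_singleton, add_neg_cancel, singleton_zero, add_zero]

/-- The inequality between affine quermassintegrals of order at least two, with its equality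
case. -/
theorem Phi_pow_mul_Phi_le {m : ℕ} (hn : 1 ≤ n) (hm : 1 ≤ m) (hj : m + 1 ≤ n)
    (K L : ConvexBody (E n)) (hK : (interior (K : Set (E n))).Nonempty)
    (hL : (interior (L : Set (E n))).Nonempty) :
    Phi hj K ^ m * Phi hj L ≤ Phi₁ hj K L ^ (m + 1) ∧
    (Phi₁ hj K L ^ (m + 1) = Phi hj K ^ m * Phi hj L ↔ Homothetic K L) := by
  have hΦK := Phi_eq_integral hj K hK
  have hΦL := Phi_eq_integral hj L hL
  have hΦV := Phi₁_eq_integral hj K L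
  have hω := omega_pos (m + 1)
  generalize coordSubspace hj = ξ at hΦK hΦL hΦV
  have hmink := fun g => minkowski_first_rpow ξ.finrank_eq (mapBody (rotProj ξ g) K)
    (mapBody (rotProj ξ g) L) (interior_rotProj_image ξ g hK) (interior_rotProj_image ξ g hL) rfl
  have hp0 : ∀ g, 0 < volume.real (rotProj ξ g '' (K : Set (E n))) := fun g =>
    measureReal_pos_of_interior volume
      (K.isCompact.image (rotProj ξ g).continuous) (interior_rotProj_image ξ g hK)
  have hq0 : ∀ g, 0 < volume.real (rotProj ξ g '' (L : Set (E n))) := fun g =>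
    measureReal_pos_of_interior volume
      (L.isCompact.image (rotProj ξ g).continuous) (interior_rotProj_image ξ g hL)
  have hv0 : ∀ g, 0 < mixedVolumePair (m + 1) (mapBody (rotProj ξ g) K)
      (mapBody (rotProj ξ g) L) := fun g =>
    (mul_pos (Real.rpow_pos_of_pos (hp0 g) _) (Real.rpow_pos_of_pos (hq0 g) _)).trans_le
      (hmink g).1
  have hmean := affineMean_geom_mean_le (μ := haarO n) hn (omega_pos n) hω hm
    (continuous_volume_image (continuous_rotProj ξ) K)
    (continuous_volume_image (continuous_rotProj ξ) L)
    (continuous_mixedVolumePair ξ K L) hp0 hq0 rfl fun g => (hmink g).1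
  replace hΦV := hΦV hv0
  change _ = affineMean (haarO n) (omega n) (omega (m + 1)) n _ at hΦK hΦL hΦV
  rw [← hΦK, ← hΦL, ← hΦV] at hmean
  refine ⟨hmean.1, fun heq => ?_, ?_⟩
  · obtain ⟨hup, hratio⟩ := hmean.2 heq
    -- The ratio of projection volumes does not depend on the rotation, so its value at `g = 1`
    -- provides the common dilation factor.
    refine homothetic_of_rotProj (Nat.succ_le_succ hm) hj ξ K L
      (Real.rpow_pos_of_pos (div_pos (hp0 1) (hq0 1)) ((m + 1 : ℕ) : ℝ)⁻¹) fun g => ?_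
    obtain ⟨t, ht⟩ := (hmink g).2 (hup g)
    refine ⟨t, fun u => ?_⟩
    rw [← hratio g 1]
    exact ht u
  · rintro ⟨c, hc, t, hKL⟩
    have hc' : 0 < c⁻¹ := inv_pos.2 hc
    have himg : ∀ g, (rotProj ξ g '' (L : Set (E n))) =
        c⁻¹ • (rotProj ξ g '' (K : Set (E n))) + {rotProj ξ g (-(c⁻¹ • t))} := by
      intro g
      rw [Homothetic.symm_eq hc hKL, image_add, image_smul_set, image_singleton]
    have hvg : ∀ g, mixedVolumePair (m + 1) (mapBody (rotProj ξ g) K) (mapBody (rotProj ξ g) L) =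
        c⁻¹ * volume.real (rotProj ξ g '' (K : Set (E n))) := fun g =>
      mixedVolumePair_of_homothetic ξ.finrank_eq _ _ hc' (himg g)
    have hqg : ∀ g, volume.real (rotProj ξ g '' (L : Set (E n))) =
        c⁻¹ ^ (m + 1) * volume.real (rotProj ξ g '' (K : Set (E n))) := by
      intro g
      rw [himg g, add_singleton, Measure.real, image_add_right, measure_preimage_add_right,
        ← Measure.real, measureReal_smul volume hc'.le, ξ.finrank_eq]
    simp only [hqg] at hΦL
    simp only [hvg] at hΦV
    -- Homogeneity of the mean gives `Φ(L) = c⁻¹ ^ (m + 1) Φ(K)` and `Φ(K, L) = c⁻¹ Φ(K)`, so both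
    -- sides agree.
    rw [affineMean_const_mul hn hω hp0 (pow_pos hc' _), ← hΦK] at hΦL
    rw [affineMean_const_mul hn hω hp0 hc', ← hΦK] at hΦV
    rw [hΦV, hΦL]
    ring

lemma Phi₁_one (hj : 1 ≤ n) (K L : ConvexBody (E n)) (hL : (interior (L : Set (E n))).Nonempty) :
    Phi₁ hj K L = Phi hj L := by
  have h : ∀ g, mixedVolumePair 1 (mapBody (rotProj (coordSubspace hj) g) K)
      (mapBody (rotProj (coordSubspace hj) g) L) =
        volume.real (rotProj (coordSubspace hj) g '' (L : Set (E n))) := fun g =>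
    mixedVolumePair_one (coordSubspace hj).finrank_eq _ _
  rw [Phi_eq_integral hj L hL, Phi₁_eq_integral hj K L]
  · simp only [h]
  · intro g
    rw [h]
    exact measureReal_pos_of_interior volume
      (L.isCompact.image (rotProj _ g).continuous) (interior_rotProj_image _ g hL)

end Quermass

end MixedAffine

end

theorem theorem2p1 (n j : ℕ) (hn : 1 ≤ n) (hj : j ≤ n)
    (K L : ConvexBody (EuclideanSpace ℝ (Fin n)))
    (hK : (interior (K : Set (EuclideanSpace ℝ (Fin n)))).Nonempty) (hK0 : 0 ∈ K)
    (hL : (interior (L : Set (EuclideanSpace ℝ (Fin n)))).Nonempty) (hL0 : 0 ∈ L) :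
    MixedAffine.Phi hj K ^ ((j : ℤ) - 1) * MixedAffine.Phi hj L ≤ MixedAffine.Phi₁ hj K L ^ j ∧
    (2 ≤ j →
      (MixedAffine.Phi₁ hj K L ^ j = MixedAffine.Phi hj K ^ ((j : ℤ) - 1) * MixedAffine.Phi hj L ↔
        MixedAffine.Homothetic K L)) := by
  match j, hj with
  | 0, hj =>
    -- For `j = 0` the exponent is `-1`. Every projection is the single point of a zero-dimensional
    -- space, so both quermassintegrals coincide and the claim is `x⁻¹ * x ≤ 1`.
    refine ⟨?_, fun h => absurd h (by norm_num)⟩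
    have h : MixedAffine.Phi hj K = MixedAffine.Phi hj L := by
      rw [MixedAffine.Phi_eq_integral hj K hK, MixedAffine.Phi_eq_integral hj L hL]
      have : Subsingleton (MixedAffine.coordSubspace hj).space :=
        Module.finrank_zero_iff.1 (MixedAffine.coordSubspace hj).finrank_eq
      have hu : ∀ (g : MixedAffine.O n) (M : ConvexBody (MixedAffine.E n)),
          MixedAffine.rotProj (MixedAffine.coordSubspace hj) g '' (M : Set (MixedAffine.E n)) =
            Set.univ := fun g M => Subsingleton.eq_univ_of_nonempty (M.nonempty.image _)
      simp only [hu]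
    rw [h]
    simpa using inv_mul_le_one
  | 1, hj =>
    refine ⟨?_, fun h => absurd h (by norm_num)⟩
    rw [MixedAffine.Phi₁_one hj K L hL]
    simp
  | m + 2, hj =>
    have h := MixedAffine.Phi_pow_mul_Phi_le hn (Nat.le_add_left 1 m) hj K L hK hL
    have e : (((m + 2 : ℕ) : ℤ) - 1) = ((m + 1 : ℕ) : ℤ) := by push_cast; ring
    rw [e, zpow_natCast]
    exact ⟨h.1, fun _ => h.2⟩
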